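/- Let $N\ge 1$. For $M\in GL(N,\mathbb C)$ let $\mathrm{Ad}_M(X)=MXM^{-1}$ on the matrix algebra $M_N(\mathbb C)$, and let $\mathrm{Inn}(M_N(\mathbb C))=\{\mathrm{Ad}_M\}$. An automorphism is diagonalizable if its eigenspaces span $M_N(\mathbb C)$. A MAD-group in $\mathrm{Inn}(M_N(\mathbb C))$ is a subgroup that is maximal, with respect to inclusion, among the abelian subgroups of $\mathrm{Inn}(M_N(\mathbb C))$ all of whose elements are diagonalizable. For $n\ge 1$ let $\omega_n=e^{2\pi i/n}$, $Q_n=\mathrm{diag}(1,\omega_n,\dots,\omega_n^{n-1})$, $(P_n)_{\rho\sigma}=\delta_{\rho+1,\sigma}$ (indices modulo $n$), and $\mathcal P_n=\{\mathrm{Ad}_{Q_n^iP_n^j} : i,j\in\mathbb Z_n\}$. Let $D(m)\subseteq \mathrm{Inn}(M_m(\mathbb C))$ be the image under $\mathrm{Ad}$ of the group of invertible diagonal $m\times m$ matrices. For groups $G,H$ of automorphisms of $M_a(\mathbb C)$ and $M_b(\mathbb C)$, let $G\otimes H=\{g\otimes h : g\in G,\ h\in H\}$, a group of automorphisms of $M_a(\mathbb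 C)\otimes M_b(\mathbb C)\cong M_{ab}(\mathbb C)$ (Kronecker product). Call $$\mathcal P_{N_1}\otimes\cdots\otimes\mathcal P_{N_f}\otimes D(m)$$ a standard group for $N$ if $f\ge 0$, every $N_i=p_i^{r_i}$ is a power of a prime with $r_i\ge 1$ (the primes need not be distinct), $m\ge 1$ and $N=N_1\cdots N_f\,m$. **Theorem 5.1 (MAD-groups in $\mathrm{Inn}(M_N(\mathbb C))$).** 1. Every MAD-group in $\mathrm{Inn}(M_N(\mathbb C))$ is conjugate in $\mathrm{Inn}(M_N(\mathbb C))$ to one and, up to the order of the factors $\mathcal P_{N_i}$, only one standard group: it is conjugate to the standard groups with a certain multiset $\{N_1,\dots,N_f\}$ and a certain $m$, in any order of the $N_i$, and to no other standard group. 2. Every standard group for $N$ is a MAD-group. Consider the gradings of $M_N(\mathbb C)$ (decompositions into a direct sum of nonzero subspaces such that the product of any two of the subspaces lies in one of them) whose subspaces are the nonzero common eigenspaces of a set of commuting diagonalizable inner automorphisms. Call such a grading fine if it has no proper refinement of the same kind, and call two gradings equivalent if an automorphism of $M_N(\mathbb C)$ carries the subspaces of one to those of the other. 3. Every such fine grading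 is equivalent to the decomposition of $M_N(\mathbb C)$ into the common eigenspaces of one and, up to the order of the factors $\mathcal P_{N_i}$ (in the same sense as in 1), only one standard group. 4. For every standard group for $N$, the decomposition into its common eigenspaces is such a fine grading. -/

import Mathlib

open scoped Kronecker TensorProduct

noncomputable section

namespace PauliMAD

/-- The algebra `M_n(ℂ)`. -/
abbrev Mat (n : ℕ) : Type := Matrix (Fin n) (Fin n) ℂ

/-- The group of automorphisms of the associative unital algebra `M_n(ℂ)`
(the group law is composition). -/
abbrev AutMat (n : ℕ) : Type := Mat n ≃ₐ[ℂ] Mat n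

/-- `Ad_A : X ↦ A X A⁻¹`, as a group homomorphism from `GL(n, ℂ)` to the automorphisms. -/
def Ad (n : ℕ) : GL (Fin n) ℂ →* AutMat n where
  toFun A := AlgEquiv.ofLinearEquiv
    { toFun := fun X => (A : Mat n) * X * ((A⁻¹ : GL (Fin n) ℂ) : Mat n)
      invFun := fun X => ((A⁻¹ : GL (Fin n) ℂ) : Mat n) * X * (A : Mat n)
      map_add' := fun X Y => by rw [mul_add, add_mul]
      map_smul' := fun c X => by simp
      left_inv := fun X => by
        simp only [mul_assoc, Units.inv_mul, mul_one, Units.inv_mul_cancel_left]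
      right_inv := fun X => by
        simp only [mul_assoc, Units.mul_inv, mul_one, Units.mul_inv_cancel_left] }
    (by simp)
    (fun X Y => by
      change (A : Mat n) * (X * Y) * ((A⁻¹ : GL (Fin n) ℂ) : Mat n) =
        ((A : Mat n) * X * ((A⁻¹ : GL (Fin n) ℂ) : Mat n)) *
          ((A : Mat n) * Y * ((A⁻¹ : GL (Fin n) ℂ) : Mat n))
      simp only [mul_assoc, Units.inv_mul_cancel_left])
  map_one' := by
    ext1 X
    change ((1 : GL (Fin n) ℂ) : Mat n) * X * (((1 : GL (Fin n) ℂ)⁻¹ : GL (Fin n) ℂ) : Mat n) = X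
    simp
  map_mul' A B := by
    ext1 X
    change ((A * B : GL (Fin n) ℂ) : Mat n) * X * (((A * B)⁻¹ : GL (Fin n) ℂ) : Mat n) =
      (A : Mat n) * ((B : Mat n) * X * ((B⁻¹ : GL (Fin n) ℂ) : Mat n)) *
        ((A⁻¹ : GL (Fin n) ℂ) : Mat n)
    simp only [mul_inv_rev, Units.val_mul, mul_assoc]

theorem Ad_apply {n : ℕ} (A : GL (Fin n) ℂ) (X : Mat n) :
    Ad n A X = (A : Mat n) * X * ((A⁻¹ : GL (Fin n) ℂ) : Mat n) := rfl

/-- The group of inner automorphisms of `M_n(ℂ)`. -/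
def Inn (n : ℕ) : Subgroup (AutMat n) := (Ad n).range

/-- An automorphism is diagonalizable if its eigenspaces span `M_n(ℂ)`. -/
def IsDiag {n : ℕ} (g : AutMat n) : Prop :=
  ⨆ μ : ℂ, Module.End.eigenspace (g.toLinearMap : Module.End ℂ (Mat n)) μ = ⊤

/-- `G` is an abelian group of diagonalizable inner automorphisms. -/
structure IsAbelianDiagInner {n : ℕ} (G : Subgroup (AutMat n)) : Prop where
  inner : G ≤ Inn n
  comm : ∀ g ∈ G, ∀ h ∈ G, g * h = h * g
  diag : ∀ g ∈ G, IsDiag g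

/-- MAD-groups in `Inn(M_n(ℂ))`: the maximal elements, with respect to inclusion, among the
abelian groups of diagonalizable inner automorphisms. -/
def IsMAD {n : ℕ} (G : Subgroup (AutMat n)) : Prop :=
  Maximal IsAbelianDiagInner G

/-- Conjugacy of subgroups by an element of `Inn(M_n(ℂ))`: `G = φ H φ⁻¹`. -/
def IsConjugate {n : ℕ} (G H : Subgroup (AutMat n)) : Prop :=
  ∃ φ ∈ Inn n, G = H.map (MulAut.conj φ).toMonoidHom

/-- The invertible diagonal `n × n` matrices, parametrized by their diagonal entries. -/
def diagGL (n : ℕ) : (Fin n → ℂˣ) →* GL (Fin n) ℂ :=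
  (Units.map (Matrix.diagonalRingHom (Fin n) ℂ : (Fin n → ℂ) →* Mat n)).comp
    (MulEquiv.piUnits (M := fun _ : Fin n => ℂ)).symm.toMonoidHom

theorem diagGL_val {n : ℕ} (d : Fin n → ℂˣ) :
    ((diagGL n d : GL (Fin n) ℂ) : Mat n) = Matrix.diagonal fun k => (d k : ℂ) := rfl

/-- `D(n)`: the image in `Inn(M_n(ℂ))` of the group of diagonal matrices. -/
def D (n : ℕ) : Subgroup (AutMat n) := ((Ad n).comp (diagGL n)).range

/-- `ω_n = exp(2πi/n)`, as a nonzero complex number. -/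
def omega (n : ℕ) : ℂˣ :=
  Units.mk0 (Complex.exp (2 * Real.pi * Complex.I / n)) (Complex.exp_ne_zero _)

/-- `Q_n = diag(1, ω_n, …, ω_n^(n-1))`. -/
def Q (n : ℕ) : GL (Fin n) ℂ := diagGL n fun k => omega n ^ (k : ℕ)

/-- `P_n`, the cyclic permutation matrix with entries `(P_n)_{ρσ} = δ_{ρ+1,σ}`
(indices modulo `n`; `finRotate n` is the map `ρ ↦ ρ + 1`). -/
def P (n : ℕ) : GL (Fin n) ℂ where
  val := Matrix.of fun ρ σ => if finRotate n ρ = σ then 1 else 0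
  inv := Matrix.of fun ρ σ => if finRotate n σ = ρ then 1 else 0
  val_inv := by
    ext ρ σ
    simp [Matrix.mul_apply, Matrix.one_apply, eq_comm]
  inv_val := by
    ext ρ σ
    rw [Matrix.mul_apply, ← Equiv.sum_comp (finRotate n).symm]
    simp only [Matrix.of_apply, Equiv.apply_symm_apply]
    simp [Matrix.one_apply, eq_comm]

theorem Q_val (n : ℕ) :
    ((Q n : GL (Fin n) ℂ) : Mat n) =
      Matrix.diagonal fun k : Fin n => Complex.exp (2 * Real.pi * Complex.I / n) ^ (k : ℕ) := by
  simp [Q, diagGL_val, omega]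

theorem P_apply (n : ℕ) (ρ σ : Fin n) :
    ((P n : GL (Fin n) ℂ) : Mat n) ρ σ = if ((ρ : ℕ) + 1) % n = σ then 1 else 0 := by
  obtain _ | n := n
  · exact ρ.elim0
  · change (if finRotate (n + 1) ρ = σ then (1 : ℂ) else 0) = _
    simp [Fin.ext_iff, Fin.val_add]

theorem omega_pow (n : ℕ) : omega n ^ n = 1 := by
  obtain _ | n := n
  · simp
  · ext
    simp only [omega, Units.val_pow_eq_pow_val, Units.val_mk0, Units.val_one]
    exact (Complex.isPrimitiveRoot_exp (n + 1) (Nat.succ_ne_zero n)).pow_eq_one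

/-- The commutation relation `P_n Q_n = ω_n Q_n P_n`. -/
theorem P_mul_Q (n : ℕ) :
    ((P n : GL (Fin n) ℂ) : Mat n) * (Q n : Mat n) =
      (omega n : ℂ) • ((Q n : Mat n) * (P n : Mat n)) := by
  have hω : (omega n : ℂ) ^ n = 1 := by
    have h := congrArg Units.val (omega_pow n)
    simpa using h
  ext ρ σ
  rw [Matrix.smul_apply, Q, diagGL_val, Matrix.mul_diagonal, Matrix.diagonal_mul, P_apply]
  split_ifs with h
  · simp only [Units.val_pow_eq_pow_val, one_mul, mul_one, smul_eq_mul, ← h, ← pow_succ']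
    exact (pow_eq_pow_mod _ hω).symm
  · simp

/-- `Ad_{Q_n}` and `Ad_{P_n}` commute. -/
theorem Ad_Q_commute_Ad_P (n : ℕ) : Commute (Ad n (Q n)) (Ad n (P n)) := by
  rw [Commute, SemiconjBy, ← map_mul, ← map_mul]
  have h1 := P_mul_Q n
  have h2 : (((P n * Q n)⁻¹ : GL (Fin n) ℂ) : Mat n) =
      ((omega n)⁻¹ : ℂˣ).val • (((Q n * P n)⁻¹ : GL (Fin n) ℂ) : Mat n) := by
    refine Units.inv_eq_of_mul_eq_one_right ?_
    rw [Units.val_mul, h1, ← Units.val_mul, smul_mul_smul_comm, Units.mul_inv, Units.mul_inv,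
      one_smul]
  ext1 X
  rw [Ad_apply, Ad_apply, h2, Units.val_mul (P n), h1, ← Units.val_mul, smul_mul_assoc,
    smul_mul_smul_comm, Units.mul_inv, one_smul]

/-- The Pauli group `𝒫_n = {Ad_{Q_n^i P_n^j}}` (the exponents matter only modulo `n`). -/
def pauli (n : ℕ) : Subgroup (AutMat n) where
  carrier := {g | ∃ i j : ℤ, g = Ad n (Q n ^ i * P n ^ j)}
  one_mem' := ⟨0, 0, by simp⟩
  mul_mem' := by
    rintro _ _ ⟨i, j, rfl⟩ ⟨k, l, rfl⟩
    refine ⟨i + k, j + l, ?_⟩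
    have h := ((Ad_Q_commute_Ad_P n).zpow_zpow k j).eq
    simp only [map_mul, map_zpow, zpow_add] at h ⊢
    rw [mul_assoc, ← mul_assoc (Ad n (P n) ^ j), ← h]
    simp only [mul_assoc]
  inv_mem' := by
    rintro _ ⟨i, j, rfl⟩
    refine ⟨-i, -j, ?_⟩
    have h := ((Ad_Q_commute_Ad_P n).zpow_zpow (-i) (-j)).eq
    simp only [map_mul, map_zpow, mul_inv_rev, ← zpow_neg] at h ⊢
    exact h.symm

/-- The isomorphism `M_a(ℂ) ⊗ M_b(ℂ) ≅ M_{ab}(ℂ)` given by the Kronecker product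
(rows and columns ordered lexicographically). -/
def kron (a b : ℕ) : (Mat a ⊗[ℂ] Mat b) ≃ₐ[ℂ] Mat (a * b) :=
  (Matrix.kroneckerAlgEquiv (Fin a) (Fin b) ℂ).trans
    (Matrix.reindexAlgEquiv ℂ ℂ finProdFinEquiv)

/-- The tensor product `g ⊗ h` of automorphisms of `M_a(ℂ)` and `M_b(ℂ)`,
an automorphism of `M_{ab}(ℂ)`. -/
def tensorAut (a b : ℕ) : AutMat a × AutMat b →* AutMat (a * b) where
  toFun g := AlgEquiv.autCongr (kron a b) (Algebra.TensorProduct.congr g.1 g.2)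
  map_one' := by
    rw [← map_one (AlgEquiv.autCongr (kron a b))]
    congr 1
    apply AlgEquiv.coe_toAlgHom_injective
    ext <;> rfl
  map_mul' g h := by
    rw [← map_mul]
    congr 1
    apply AlgEquiv.coe_toAlgHom_injective
    ext <;> simp

/-- `g ⊗ h` sends the Kronecker product of `X` and `Y` to that of `g X` and `h Y`. -/
theorem tensorAut_kron (a b : ℕ) (g : AutMat a) (h : AutMat b) (X : Mat a) (Y : Mat b) :
    tensorAut a b (g, h) (kron a b (X ⊗ₜ Y)) = kron a b (g X ⊗ₜ h Y) := by
  simp [tensorAut]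

theorem kron_tmul (a b : ℕ) (X : Mat a) (Y : Mat b) :
    kron a b (X ⊗ₜ Y) = (X ⊗ₖ Y).reindex finProdFinEquiv finProdFinEquiv := by
  simp [kron]

/-- `G ⊗ H = {g ⊗ h | g ∈ G, h ∈ H}`. -/
def tensorGroup {a b : ℕ} (G : Subgroup (AutMat a)) (H : Subgroup (AutMat b)) :
    Subgroup (AutMat (a * b)) :=
  (G.prod H).map (tensorAut a b)

/-- The identification of the automorphism groups for two equal sizes. -/
def castAut {a b : ℕ} (h : a = b) : AutMat a ≃* AutMat b :=
  AlgEquiv.autCongr (Matrix.reindexAlgEquiv ℂ ℂ (finCongr h))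

/-- `𝒫_{N₁} ⊗ ⋯ ⊗ 𝒫_{N_f} ⊗ D(m)` for the list `[N₁, …, N_f]`. -/
def pauliD : (L : List ℕ) → (m : ℕ) → Subgroup (AutMat (L.prod * m))
  | [], m => (D m).map (castAut (by simp)).toMonoidHom
  | n :: L, m => (tensorGroup (pauli n) (pauliD L m)).map
      (castAut (by rw [List.prod_cons, mul_assoc])).toMonoidHom

/-- The admissible data for size `N`: prime powers `N₁, …, N_f` (all greater than `1`, repetitions
allowed, `f = 0` allowed) and a number `m` such that `N = N₁ ⋯ N_f · m`. -/
structure Admissible (N : ℕ) (L : List ℕ) (m : ℕ) : Prop where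
  primePow : ∀ n ∈ L, IsPrimePow n
  prod_eq : L.prod * m = N

/-- The group `𝒫_{N₁} ⊗ ⋯ ⊗ 𝒫_{N_f} ⊗ D(m)` as a group of automorphisms of `M_N(ℂ)`. -/
def standard {N : ℕ} (L : List ℕ) (m : ℕ) (h : Admissible N L m) : Subgroup (AutMat N) :=
  (pauliD L m).map (castAut h.prod_eq).toMonoidHom

/-- The common eigenspaces of a set of automorphisms:
all nonzero subspaces `{X | g X = χ(g) X for all g ∈ S}`, where `χ` assigns scalars to
the elements of `S`. -/
def eigenDecomposition {n : ℕ} (S : Set (AutMat n)) : Set (Submodule ℂ (Mat n)) :=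
  {V | V ≠ ⊥ ∧ ∃ χ : AutMat n → ℂ,
    V = ⨅ g ∈ S, Module.End.eigenspace (g.toLinearMap : Module.End ℂ (Mat n)) (χ g)}

/-- Gradings of `M_n(ℂ)`, given by the set `Γ` of their nonzero homogeneous subspaces: `M_n(ℂ)` is
the direct sum of the members of `Γ`, and the product of two members lies in some member. -/
structure IsGrading {n : ℕ} (Γ : Set (Submodule ℂ (Mat n))) : Prop where
  ne_bot : ∀ V ∈ Γ, V ≠ ⊥
  indep : sSupIndep Γ
  span : sSup Γ = ⊤
  mul : ∀ V ∈ Γ, ∀ W ∈ Γ, ∃ U ∈ Γ, ∀ x ∈ V, ∀ y ∈ W, x * y ∈ U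

/-- Gradings induced by a set of commuting diagonalizable inner automorphisms. -/
def IsInnerGrading {n : ℕ} (Γ : Set (Submodule ℂ (Mat n))) : Prop :=
  IsGrading Γ ∧ ∃ S : Set (AutMat n), (∀ g ∈ S, g ∈ Inn n) ∧ (∀ g ∈ S, IsDiag g) ∧
    (∀ g ∈ S, ∀ h ∈ S, g * h = h * g) ∧ Γ = eigenDecomposition S

/-- `Γ'` refines `Γ`. -/
def Refines {n : ℕ} (Γ' Γ : Set (Submodule ℂ (Mat n))) : Prop :=
  ∀ V ∈ Γ', ∃ W ∈ Γ, V ≤ W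

/-- Fine gradings induced by inner automorphisms: those which have no proper refinement that is
again induced by inner automorphisms. -/
def IsFineInnerGrading {n : ℕ} (Γ : Set (Submodule ℂ (Mat n))) : Prop :=
  IsInnerGrading Γ ∧ ∀ Γ', IsInnerGrading Γ' → Refines Γ' Γ → Γ' = Γ

/-- Equivalence of gradings: an automorphism of `M_n(ℂ)` carries the homogeneous subspaces of `Δ`
to those of `Γ`. -/
def GradingEquiv {n : ℕ} (Γ Δ : Set (Submodule ℂ (Mat n))) : Prop :=
  ∃ φ : AutMat n, Γ = (fun V => V.map (φ.toLinearMap : Mat n →ₗ[ℂ] Mat n)) '' Δ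

end PauliMAD

end

/-! By Skolem–Noether every automorphism is some `Ad_A`, and `Ad_A`, `Ad_B` commute exactly when `A`
and `B` commute up to a scalar; determinants force this scalar to be an `N`-th root of unity. An
abelian group `G` of diagonalizable automorphisms thus carries a commutation pairing.

If the pairing is trivial, all lifts commute and are diagonalizable, so `G` lies in a conjugate of
`D(N)` (`exists_le_autEquiv_D`). Otherwise let a prime `p` divide the order of some value, and let
`n = p^r` be the largest power of `p` dividing the order of a value. Powers prime to `p` give lifts
`A`, `B` with pairing `ω_n` whose pairings with all of `G` are `n`-th roots of unity
(`exists_pair_of_lifts_not_commute`). Then `G` fixes `A^n` and `B^n`, and dividing by `n`-th roots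
that are polynomials in these makes both lifts of order dividing `n`. They now satisfy the relations
of `Q_n` and `P_n`, which splits the algebra as `M_n ⊗ M_b` and puts `G` inside `𝒫_n ⊗ H`; induction
on `N` applies to `H`. So `G` lies in a conjugate of a standard group, and equals it if `G` is
maximal.

Conversely, standard groups are their own centralizers, hence maximal. They are told apart by the
index of the `k`-th powers: `D(m)` is divisible and contributes nothing, so the index is the square
of the product of the `gcd(N_i, k)`. Letting `k` run through prime powers recovers the multiset of
the `N_i`, and the size then gives `m`.

For gradings, `scalarGroup` and `eigenDecomposition` form a Galois correspondence that matches fine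
gradings with MAD-groups and equivalence with conjugacy. -/

noncomputable section

namespace PauliMAD

/-! ### Diagonalizable operators as semisimple operators -/

section Semisimple

variable {V W : Type*} [AddCommGroup V] [Module ℂ V] [AddCommGroup W] [Module ℂ W]

/-- The product of `X - μ` over the distinct eigenvalues is squarefree and kills every eigenvector.
-/
theorem isSemisimple_iff_iSup_eigenspace_eq_top [FiniteDimensional ℂ V] {f : Module.End ℂ V} :
    f.IsSemisimple ↔ ⨆ μ : ℂ, f.eigenspace μ = ⊤ := by
  classical
  refine ⟨fun h => h.iSup_eigenspace_eq_top, fun h => ?_⟩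
  have hfin := Module.End.finite_hasEigenvalue f
  have hsq : Squarefree (∏ μ ∈ hfin.toFinset, (Polynomial.X - Polynomial.C μ)) :=
    (Polynomial.separable_prod_X_sub_C_iff'.2 fun x _ y _ hxy => hxy).squarefree
  refine Module.End.isSemisimple_of_squarefree_aeval_eq_zero hsq ?_
  rw [← LinearMap.ker_eq_top, eq_top_iff, ← h]
  refine iSup_le fun μ v hv => ?_
  by_cases hv0 : v = 0
  · simp [hv0]
  have hev : f.HasEigenvector μ v := ⟨hv, hv0⟩
  rw [LinearMap.mem_ker, Module.End.aeval_apply_of_hasEigenvector hev, Polynomial.eval_prod,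
    Finset.prod_eq_zero (i := μ), zero_smul]
  · simpa using Module.End.hasEigenvalue_of_hasEigenvector hev
  · simp

theorem aeval_intertwine {f : Module.End ℂ V} {g : Module.End ℂ W} (T : V →ₗ[ℂ] W)
    (h : ∀ v, T (f v) = g (T v)) (p : Polynomial ℂ) (v : V) :
    T (Polynomial.aeval f p v) = Polynomial.aeval g p (T v) := by
  induction p using Polynomial.induction_on' with
  | add p q hp hq => simp [hp, hq]
  | monomial k a =>
    have : ∀ v, T ((f ^ k) v) = (g ^ k) (T v) := by
      induction k with
      | zero => simp
      | succ k ih => intro v; rw [pow_succ, pow_succ, Module.End.mul_apply, ih, h]; rfl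
    simp [Polynomial.aeval_monomial, this]

theorem isSemisimple_of_surjective [FiniteDimensional ℂ V] {f : Module.End ℂ V} {g : Module.End ℂ W} (hf : f.IsSemisimple)
    (T : V →ₗ[ℂ] W) (hT : Function.Surjective T) (h : ∀ v, T (f v) = g (T v)) :
    g.IsSemisimple := by
  refine Module.End.isSemisimple_of_squarefree_aeval_eq_zero hf.minpoly_squarefree ?_
  ext w
  obtain ⟨v, rfl⟩ := hT w
  rw [← aeval_intertwine T h, minpoly.aeval]
  simp

theorem isSemisimple_of_injective [FiniteDimensional ℂ V] {f : Module.End ℂ V} {g : Module.End ℂ W} (hf : f.IsSemisimple)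
    (T : W →ₗ[ℂ] V) (hT : Function.Injective T) (h : ∀ w, T (g w) = f (T w)) :
    g.IsSemisimple := by
  refine Module.End.isSemisimple_of_squarefree_aeval_eq_zero hf.minpoly_squarefree ?_
  ext w
  apply hT
  rw [aeval_intertwine T h, minpoly.aeval]
  simp

theorem isSemisimple_of_pow_eq_one {f : Module.End ℂ V} {n : ℕ} (hn : n ≠ 0) (h : f ^ n = 1) :
    f.IsSemisimple := by
  refine Module.End.isSemisimple_of_squarefree_aeval_eq_zero
    (p := Polynomial.X ^ n - 1) ?_ (by simp [h])
  have := (Polynomial.separable_X_pow_sub_C (1 : ℂ) (n := n) (by exact_mod_cast hn)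
    one_ne_zero).squarefree
  simpa using this

end Semisimple

/-! ### Skolem–Noether and diagonalizable automorphisms -/

section Inner

variable {n : ℕ}

/-- Skolem–Noether: on `End(ℂ^n)` an automorphism is conjugation by a linear equivalence `T`, whose
matrix is the required lift. -/
theorem Ad_surjective : Function.Surjective (Ad n) := by
  intro g
  obtain ⟨T, hT⟩ := AlgEquiv.eq_linearEquivConjAlgEquiv
    ((Matrix.toLinAlgEquiv' (R := ℂ) (n := Fin n)).symm.trans
      (g.trans (Matrix.toLinAlgEquiv' (R := ℂ) (n := Fin n))))
  let A : Mat n := LinearMap.toMatrixAlgEquiv' T.toLinearMap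
  let B : Mat n := LinearMap.toMatrixAlgEquiv' T.symm.toLinearMap
  refine ⟨⟨A, B, ?_, ?_⟩, ?_⟩
  · rw [← map_mul, ← map_one (LinearMap.toMatrixAlgEquiv' (R := ℂ) (n := Fin n))]
    exact congrArg _ (LinearMap.ext fun x => T.apply_symm_apply x)
  · rw [← map_mul, ← map_one (LinearMap.toMatrixAlgEquiv' (R := ℂ) (n := Fin n))]
    exact congrArg _ (LinearMap.ext fun x => T.symm_apply_apply x)
  · ext1 X
    have h := congrArg LinearMap.toMatrixAlgEquiv' (AlgEquiv.congr_fun hT (Matrix.toLinAlgEquiv' X))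
    simp only [AlgEquiv.trans_apply, AlgEquiv.symm_apply_apply] at h
    rw [LinearMap.toMatrixAlgEquiv'_toLinAlgEquiv'] at h
    rw [h, Ad_apply]
    change A * X * B = _
    rw [LinearEquiv.conjAlgEquiv_apply]
    conv_lhs => rw [← LinearMap.toMatrixAlgEquiv'_toLinAlgEquiv' X]
    simp only [A, B, ← map_mul]
    rfl

theorem Inn_eq_top : Inn n = ⊤ := MonoidHom.range_eq_top.2 Ad_surjective

theorem mem_Inn (g : AutMat n) : g ∈ Inn n := by rw [Inn_eq_top]; trivial

theorem isDiag_iff {g : AutMat n} : IsDiag g ↔ Module.End.IsSemisimple g.toLinearMap :=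
  isSemisimple_iff_iSup_eigenspace_eq_top.symm

theorem IsDiag.mul {g h : AutMat n} (hg : IsDiag g) (hh : IsDiag h) (hc : g * h = h * g) :
    IsDiag (g * h) := by
  rw [isDiag_iff] at *
  refine Module.End.IsSemisimple.mul_of_commute (f := g.toLinearMap) (g := h.toLinearMap)
    ?_ hg hh
  ext1 x
  exact AlgEquiv.congr_fun hc x

theorem isDiag_of_pow_eq_one {g : AutMat n} {k : ℕ} (hk : k ≠ 0) (h : g ^ k = 1) : IsDiag g := by
  rw [isDiag_iff]
  refine isSemisimple_of_pow_eq_one hk ?_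
  have : ∀ j : ℕ, (g.toLinearMap : Module.End ℂ (Mat n)) ^ j = (g ^ j).toLinearMap := by
    intro j
    induction j with
    | zero => rfl
    | succ j ih => rw [pow_succ, ih, pow_succ]; rfl
  rw [this, h]
  rfl

end Inner

/-! ### Galois correspondence between gradings and groups -/

section Gradings

variable {n : ℕ}

/-- The subspace on which every `g ∈ S` acts as the scalar `χ g`. -/
def commonEigenspace (S : Set (AutMat n)) (χ : AutMat n → ℂ) : Submodule ℂ (Mat n) :=
  ⨅ g ∈ S, Module.End.eigenspace (g.toLinearMap : Module.End ℂ (Mat n)) (χ g)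

theorem mem_commonEigenspace {S : Set (AutMat n)} {χ : AutMat n → ℂ} {x : Mat n} :
    x ∈ commonEigenspace S χ ↔ ∀ g ∈ S, g x = χ g • x := by
  simp [commonEigenspace, Submodule.mem_iInf]

/-- A set of commuting diagonalizable automorphisms. -/
structure IsCommDiag (S : Set (AutMat n)) : Prop where
  diag : ∀ g ∈ S, IsDiag g
  comm : ∀ g ∈ S, ∀ h ∈ S, g * h = h * g

theorem isAbelianDiagInner_iff {G : Subgroup (AutMat n)} :
    IsAbelianDiagInner G ↔ IsCommDiag (G : Set (AutMat n)) :=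
  ⟨fun h => ⟨h.diag, h.comm⟩, fun h => ⟨fun g _ => mem_Inn g, h.comm, h.diag⟩⟩

/-- Simultaneous diagonalization gives the direct sum. Multiplicativity of the automorphisms puts a
product of `χ`- and `ψ`-eigenvectors into the `χψ`-eigenspace. -/
theorem IsCommDiag.isGrading {S : Set (AutMat n)} (hS : IsCommDiag S) :
    IsGrading (eigenDecomposition S) := by
  classical
  let f : S → Module.End ℂ (Mat n) := fun g => g.1.toLinearMap
  have hss (i : S) : (f i).IsSemisimple := isDiag_iff.1 (hS.diag i.1 i.2)
  have hgen (i : S) (μ : ℂ) : (f i).maxGenEigenspace μ = (f i).eigenspace μ :=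
    (hss i).isFinitelySemisimple.maxGenEigenspace_eq_eigenspace μ
  have hcomm (i j : S) : Commute (f i) (f j) := by
    refine LinearMap.ext fun x => ?_
    exact AlgEquiv.congr_fun (hS.comm i.1 i.2 j.1 j.2) x
  have hmaps (i j : S) (φ : ℂ) :
      Set.MapsTo (f i) ((f j).maxGenEigenspace φ) ((f j).maxGenEigenspace φ) :=
    Module.End.mapsTo_maxGenEigenspace_of_comm (hcomm j i) φ
  have hE (χ : AutMat n → ℂ) :
      commonEigenspace S χ = ⨅ i, (f i).maxGenEigenspace (χ i.1) := by
    simp only [hgen]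
    exact iInf_subtype'
  -- Scalars are given only on `S`; the value 0 elsewhere is irrelevant.
  have hE' (χ : S → ℂ) : ⨅ i, (f i).maxGenEigenspace (χ i) =
      commonEigenspace S (fun g => if h : g ∈ S then χ ⟨g, h⟩ else 0) := by
    rw [hE]
    simp
  refine ⟨fun V hV => hV.1, ?_, ?_, ?_⟩
  · refine (Module.End.independent_iInf_maxGenEigenspace_of_forall_mapsTo f hmaps).sSupIndep_range.mono
      ?_
    rintro _ ⟨_, χ, rfl⟩
    exact ⟨fun i => χ i.1, (hE χ).symm⟩
  · rw [eq_top_iff, ← Module.End.iSup_iInf_maxGenEigenspace_eq_top_of_forall_mapsTo f hmaps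
      (fun i => by simp only [hgen]; exact (hss i).iSup_eigenspace_eq_top)]
    refine iSup_le fun χ => ?_
    by_cases h0 : ⨅ i, (f i).maxGenEigenspace (χ i) = ⊥
    · rw [h0]; exact bot_le
    · exact le_sSup ⟨h0, _, hE' χ⟩
  · rintro V ⟨hV, χ, hχ⟩ W ⟨hW, ψ, hψ⟩
    -- A zero eigenspace is not a member of the grading; then all these products vanish and any
    -- member, here `V`, contains them.
    by_cases h0 : commonEigenspace S (χ * ψ) = ⊥
    · refine ⟨V, ⟨hV, χ, hχ⟩, fun x hx y hy => ?_⟩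
      have : x * y ∈ commonEigenspace S (χ * ψ) := by
        rw [hχ] at hx
        rw [hψ] at hy
        refine mem_commonEigenspace.2 fun g hg => ?_
        rw [map_mul, mem_commonEigenspace.1 hx g hg, mem_commonEigenspace.1 hy g hg,
          smul_mul_smul_comm]
        rfl
      rw [h0, Submodule.mem_bot] at this
      rw [this]
      exact zero_mem V
    · refine ⟨_, ⟨h0, _, rfl⟩, fun x hx y hy => ?_⟩
      rw [hχ] at hx
      rw [hψ] at hy
      refine mem_commonEigenspace.2 fun g hg => ?_
      rw [map_mul, mem_commonEigenspace.1 hx g hg, mem_commonEigenspace.1 hy g hg,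
        smul_mul_smul_comm]
      rfl

theorem IsCommDiag.isInnerGrading {S : Set (AutMat n)} (hS : IsCommDiag S) :
    IsInnerGrading (eigenDecomposition S) :=
  ⟨hS.isGrading, S, fun g _ => mem_Inn g, hS.diag, hS.comm, rfl⟩

theorem IsInnerGrading.exists_eq {Γ : Set (Submodule ℂ (Mat n))} (h : IsInnerGrading Γ) :
    ∃ S, IsCommDiag S ∧ Γ = eigenDecomposition S := by
  obtain ⟨_, S, _, hd, hc, rfl⟩ := h
  exact ⟨S, ⟨hd, hc⟩, rfl⟩

/-- The automorphisms which act as a scalar on each member of `Γ`. -/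
def scalarGroup (Γ : Set (Submodule ℂ (Mat n))) : Subgroup (AutMat n) where
  carrier := {g | ∀ V ∈ Γ, ∃ c : ℂ, ∀ x ∈ V, g x = c • x}
  one_mem' := fun V _ => ⟨1, fun x _ => by simp⟩
  mul_mem' := by
    intro g h hg hh V hV
    obtain ⟨c, hc⟩ := hg V hV
    obtain ⟨d, hd⟩ := hh V hV
    exact ⟨d * c, fun x hx => by rw [AlgEquiv.mul_apply, hd x hx, map_smul, hc x hx, smul_smul]⟩
  inv_mem' := by
    intro g hg V hV
    obtain ⟨c, hc⟩ := hg V hV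
    refine ⟨c⁻¹, fun x hx => ?_⟩
    have hx' := hc x hx
    apply g.injective
    change g (g.symm x) = _
    rw [AlgEquiv.apply_symm_apply, map_smul, hx', smul_smul]
    by_cases h0 : c = 0
    · rw [h0, zero_smul, map_eq_zero_iff _ g.injective] at hx'
      simp [hx']
    · rw [inv_mul_cancel₀ h0, one_smul]

theorem mem_scalarGroup {Γ : Set (Submodule ℂ (Mat n))} {g : AutMat n} :
    g ∈ scalarGroup Γ ↔ ∀ V ∈ Γ, ∃ c : ℂ, ∀ x ∈ V, g x = c • x := Iff.rfl

theorem isCommDiag_scalarGroup {Γ : Set (Submodule ℂ (Mat n))} (hΓ : sSup Γ = ⊤) :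
    IsCommDiag (scalarGroup Γ : Set (AutMat n)) where
  diag g hg := by
    unfold IsDiag
    rw [eq_top_iff, ← hΓ]
    refine sSup_le fun V hV => ?_
    obtain ⟨c, hc⟩ := hg V hV
    exact le_iSup_of_le c fun x hx => Module.End.mem_eigenspace_iff.2 (hc x hx)
  comm g hg h hh := by
    have : LinearMap.eqLocus ((g * h).toLinearMap : Mat n →ₗ[ℂ] Mat n) (h * g).toLinearMap = ⊤ := by
      rw [eq_top_iff, ← hΓ]
      refine sSup_le fun V hV x hx => ?_
      obtain ⟨c, hc⟩ := hg V hV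
      obtain ⟨d, hd⟩ := hh V hV
      change g (h x) = h (g x)
      rw [hc x hx, hd x hx, map_smul, map_smul, hc x hx, hd x hx, smul_comm]
    ext1 x
    exact (this.ge (Submodule.mem_top : x ∈ ⊤) :)

theorem subset_scalarGroup_eigenDecomposition (S : Set (AutMat n)) :
    S ⊆ scalarGroup (eigenDecomposition S) := by
  rintro g hg V ⟨_, χ, rfl⟩
  exact ⟨χ g, fun x hx => mem_commonEigenspace.1 hx g hg⟩

theorem scalarGroup_mono {Γ Δ : Set (Submodule ℂ (Mat n))} (h : Refines Δ Γ) :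
    scalarGroup Γ ≤ scalarGroup Δ := by
  intro g hg V hV
  obtain ⟨W, hW, hVW⟩ := h V hV
  obtain ⟨c, hc⟩ := hg W hW
  exact ⟨c, fun x hx => hc x (hVW hx)⟩

theorem refines_eigenDecomposition {S T : Set (AutMat n)} (h : S ⊆ T) :
    Refines (eigenDecomposition T) (eigenDecomposition S) := by
  rintro V ⟨hV, χ, rfl⟩
  have hle : commonEigenspace T χ ≤ commonEigenspace S χ := fun x hx =>
    mem_commonEigenspace.2 fun g hg => mem_commonEigenspace.1 hx g (h hg)
  refine ⟨_, ⟨fun h0 => hV ?_, χ, rfl⟩, hle⟩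
  exact le_bot_iff.1 (hle.trans h0.le)

theorem refines_eigenDecomposition_scalarGroup {Γ : Set (Submodule ℂ (Mat n))}
    (hΓ : ∀ V ∈ Γ, V ≠ ⊥) : Refines Γ (eigenDecomposition (scalarGroup Γ : Set (AutMat n))) := by
  classical
  intro V hV
  have h (g : AutMat n) : ∃ c : ℂ, g ∈ scalarGroup Γ → ∀ x ∈ V, g x = c • x := by
    by_cases hg : g ∈ scalarGroup Γ
    · obtain ⟨c, hc⟩ := hg V hV
      exact ⟨c, fun _ => hc⟩
    · exact ⟨0, fun h => absurd h hg⟩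
  choose χ hχ using h
  have hle : V ≤ commonEigenspace (scalarGroup Γ : Set (AutMat n)) χ := fun x hx =>
    mem_commonEigenspace.2 fun g hg => hχ g hg x hx
  exact ⟨_, ⟨fun h0 => hΓ V hV (le_bot_iff.1 (hle.trans h0.le)), χ, rfl⟩, hle⟩

/-- From `V ≤ W ≤ V'` with `V`, `V'` in `Γ`, independence forces `V = V'`, hence `V = W`. -/
theorem subset_of_refines_of_refines {Γ Δ : Set (Submodule ℂ (Mat n))} (hΓ : IsGrading Γ)
    (h₁ : Refines Γ Δ) (h₂ : Refines Δ Γ) : Γ ⊆ Δ := by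
  intro V hV
  obtain ⟨W, hW, hVW⟩ := h₁ V hV
  obtain ⟨V', hV', hWV'⟩ := h₂ W hW
  have : V = V' := by
    by_contra hne
    exact hΓ.ne_bot V hV (le_bot_iff.1
      (hΓ.indep.pairwiseDisjoint hV hV' hne le_rfl (hVW.trans hWV')))
  subst this
  rwa [le_antisymm hVW hWV']

/-- Inner gradings are the closed elements of the Galois correspondence: each side refines the
other. -/
theorem eigenDecomposition_scalarGroup {Γ : Set (Submodule ℂ (Mat n))} (hΓ : IsInnerGrading Γ) :
    eigenDecomposition (scalarGroup Γ : Set (AutMat n)) = Γ := by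
  have h₁ := refines_eigenDecomposition_scalarGroup hΓ.1.ne_bot
  have h₂ : Refines (eigenDecomposition (scalarGroup Γ : Set (AutMat n))) Γ := by
    obtain ⟨S, _, rfl⟩ := hΓ.exists_eq
    exact refines_eigenDecomposition (subset_scalarGroup_eigenDecomposition S)
  exact (subset_of_refines_of_refines (isCommDiag_scalarGroup hΓ.1.span).isGrading h₂ h₁).antisymm
    (subset_of_refines_of_refines hΓ.1 h₁ h₂)

/-- A larger abelian group would refine `Γ`, hence has `Γ` itself as its decomposition, and so acts
by scalars on the members of `Γ`. -/
theorem IsFineInnerGrading.isMAD_scalarGroup {Γ : Set (Submodule ℂ (Mat n))}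
    (hΓ : IsFineInnerGrading Γ) : IsMAD (scalarGroup Γ) := by
  refine ⟨isAbelianDiagInner_iff.2 (isCommDiag_scalarGroup hΓ.1.1.span), fun H hH hle => ?_⟩
  have hH' := isAbelianDiagInner_iff.1 hH
  have h : eigenDecomposition (H : Set (AutMat n)) = Γ := by
    refine hΓ.2 _ hH'.isInnerGrading ?_
    have := refines_eigenDecomposition (show (scalarGroup Γ : Set (AutMat n)) ⊆ H from hle)
    rwa [eigenDecomposition_scalarGroup hΓ.1] at this
  have h' := subset_scalarGroup_eigenDecomposition (H : Set (AutMat n))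
  rwa [h] at h'

theorem IsMAD.scalarGroup_eq {G : Subgroup (AutMat n)} (hG : IsMAD G) :
    scalarGroup (eigenDecomposition (G : Set (AutMat n))) = G :=
  (Maximal.eq_of_le hG (isAbelianDiagInner_iff.2
    (isCommDiag_scalarGroup (isAbelianDiagInner_iff.1 hG.1).isGrading.span))
    (subset_scalarGroup_eigenDecomposition (G : Set (AutMat n)))).symm

/-- A refinement has a larger scalar group, which by maximality is `G` again; its decomposition
gives back the refinement. -/
theorem IsMAD.isFineInnerGrading {G : Subgroup (AutMat n)} (hG : IsMAD G) :
    IsFineInnerGrading (eigenDecomposition (G : Set (AutMat n))) := by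
  refine ⟨(isAbelianDiagInner_iff.1 hG.1).isInnerGrading, fun Γ hΓ href => ?_⟩
  have hle : G ≤ scalarGroup Γ := hG.scalarGroup_eq.ge.trans (scalarGroup_mono href)
  have heq := Maximal.eq_of_le hG
    (isAbelianDiagInner_iff.2 (isCommDiag_scalarGroup hΓ.1.span)) hle
  rw [heq, eigenDecomposition_scalarGroup hΓ]

theorem map_scalarGroup (φ : AutMat n) (Δ : Set (Submodule ℂ (Mat n))) :
    scalarGroup ((fun V => V.map (φ.toLinearMap : Mat n →ₗ[ℂ] Mat n)) '' Δ) =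
      (scalarGroup Δ).map (MulAut.conj φ).toMonoidHom := by
  ext g
  rw [Subgroup.mem_map_equiv, MulAut.conj_symm_apply, mem_scalarGroup, mem_scalarGroup,
    Set.forall_mem_image]
  refine forall₂_congr fun V _ => exists_congr fun c => ?_
  constructor
  · intro h x hx
    have := h (φ x) (Submodule.mem_map_of_mem hx)
    apply φ.injective
    change φ (φ.symm (g (φ x))) = _
    rw [AlgEquiv.apply_symm_apply, this, map_smul]
  · rintro h _ ⟨x, hx, rfl⟩
    have := congrArg φ (h x hx)
    change φ (φ.symm (g (φ x))) = _ at this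
    rw [AlgEquiv.apply_symm_apply, map_smul] at this
    exact this

theorem map_eigenDecomposition_subset (φ : AutMat n) (H : Subgroup (AutMat n)) :
    (fun V => V.map (φ.toLinearMap : Mat n →ₗ[ℂ] Mat n)) '' eigenDecomposition (H : Set (AutMat n)) ⊆
      eigenDecomposition (H.map (MulAut.conj φ).toMonoidHom : Set (AutMat n)) := by
  rintro _ ⟨V, ⟨hV, χ, rfl⟩, rfl⟩
  refine ⟨fun h0 => hV (Submodule.map_injective_of_injective
    (f := (φ.toLinearMap : Mat n →ₗ[ℂ] Mat n)) φ.injective (h0.trans (Submodule.map_bot _).symm)),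
    fun g => χ (φ⁻¹ * g * φ), ?_⟩
  ext x
  change _ ↔ x ∈ commonEigenspace _ _
  rw [mem_commonEigenspace]
  constructor
  · rintro ⟨y, hy, rfl⟩ _ ⟨h, hh, rfl⟩
    have := mem_commonEigenspace.1 hy h hh
    change φ (h (φ.symm (φ y))) = χ (φ⁻¹ * (φ * h * φ⁻¹) * φ) • φ y
    rw [AlgEquiv.symm_apply_apply, this, map_smul]
    congr 2
    group
  · intro hx
    refine ⟨φ.symm x, mem_commonEigenspace.2 fun h hh => ?_, φ.apply_symm_apply x⟩
    have := hx (φ * h * φ⁻¹) ⟨h, hh, rfl⟩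
    apply φ.injective
    rw [map_smul, AlgEquiv.apply_symm_apply]
    change φ (h (φ.symm x)) = _ at this
    rw [this]
    congr 2
    group

theorem isConjugate_iff {G H : Subgroup (AutMat n)} :
    IsConjugate G H ↔ ∃ φ : AutMat n, G = H.map (MulAut.conj φ).toMonoidHom := by
  simp [IsConjugate, Inn_eq_top]

theorem gradingEquiv_eigenDecomposition_iff {G H : Subgroup (AutMat n)} (hG : IsMAD G)
    (hH : IsMAD H) : GradingEquiv (eigenDecomposition (G : Set (AutMat n)))
      (eigenDecomposition (H : Set (AutMat n))) ↔ IsConjugate G H := by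
  rw [isConjugate_iff]
  refine exists_congr fun φ => ⟨fun h => ?_, ?_⟩
  · rw [← hG.scalarGroup_eq, h, map_scalarGroup, hH.scalarGroup_eq]
  · rintro rfl
    refine Set.Subset.antisymm ?_ (map_eigenDecomposition_subset φ H)
    intro V hV
    -- The reverse inclusion is the inclusion for `φ⁻¹` and the conjugated group.
    have h := map_eigenDecomposition_subset φ⁻¹ (H.map (MulAut.conj φ).toMonoidHom)
    rw [Subgroup.map_map] at h
    have hid : (MulAut.conj φ⁻¹).toMonoidHom.comp (MulAut.conj φ).toMonoidHom =
        MonoidHom.id (AutMat n) := by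
      ext1 x
      simp [mul_assoc]
    rw [hid, Subgroup.map_id] at h
    refine ⟨_, h ⟨V, hV, rfl⟩, ?_⟩
    ext x
    simp only [Submodule.mem_map]
    constructor
    · rintro ⟨_, ⟨y, hy, rfl⟩, rfl⟩
      change φ (φ.symm y) ∈ V
      rwa [AlgEquiv.apply_symm_apply]
    · intro hx
      exact ⟨φ.symm x, ⟨x, hx, rfl⟩, φ.apply_symm_apply x⟩

end Gradings

/-! ### Conjugacy across equal matrix sizes; self-centralizing groups -/

section AutEquiv

variable {a b c a' b' : ℕ}

/-- An isomorphism of matrix algebras carries the group `G` to the group `H`. -/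
def AutEquiv (G : Subgroup (AutMat a)) (H : Subgroup (AutMat b)) : Prop :=
  ∃ φ : Mat a ≃ₐ[ℂ] Mat b, H = G.map (AlgEquiv.autCongr φ).toMonoidHom

theorem AutEquiv.refl (G : Subgroup (AutMat a)) : AutEquiv G G := by
  refine ⟨AlgEquiv.refl, ?_⟩
  rw [AlgEquiv.autCongr_refl]
  exact (Subgroup.map_id G).symm

theorem AutEquiv.symm {G : Subgroup (AutMat a)} {H : Subgroup (AutMat b)} (h : AutEquiv G H) :
    AutEquiv H G := by
  obtain ⟨φ, rfl⟩ := h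
  refine ⟨φ.symm, ?_⟩
  rw [Subgroup.map_map]
  conv_lhs => rw [← Subgroup.map_id G]
  congr 1
  ext1 x
  change x = AlgEquiv.autCongr φ.symm (AlgEquiv.autCongr φ x)
  rw [← AlgEquiv.autCongr_symm, MulEquiv.symm_apply_apply]

theorem AutEquiv.trans {G : Subgroup (AutMat a)} {H : Subgroup (AutMat b)}
    {K : Subgroup (AutMat c)} (h : AutEquiv G H) (h' : AutEquiv H K) : AutEquiv G K := by
  obtain ⟨φ, rfl⟩ := h
  obtain ⟨ψ, rfl⟩ := h'
  refine ⟨φ.trans ψ, ?_⟩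
  rw [Subgroup.map_map]
  rfl

theorem autEquiv_castAut (h : a = b) (G : Subgroup (AutMat a)) :
    AutEquiv G (G.map (castAut h).toMonoidHom) := ⟨_, rfl⟩

theorem AutEquiv.size_eq {G : Subgroup (AutMat a)} {H : Subgroup (AutMat b)} (h : AutEquiv G H) :
    a = b := by
  obtain ⟨φ, -⟩ := h
  have := φ.toLinearEquiv.finrank_eq
  rw [Module.finrank_matrix, Module.finrank_matrix] at this
  simp only [Fintype.card_fin, Module.finrank_self, mul_one] at this
  exact Nat.mul_self_inj.1 this

theorem autEquiv_iff_isConjugate {G H : Subgroup (AutMat a)} :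
    AutEquiv H G ↔ IsConjugate G H := by
  rw [isConjugate_iff]
  rfl

theorem AutEquiv.isAbelianDiagInner {G : Subgroup (AutMat a)} {H : Subgroup (AutMat b)}
    (h : AutEquiv G H) (hG : IsAbelianDiagInner G) : IsAbelianDiagInner H := by
  obtain ⟨φ, rfl⟩ := h
  refine ⟨fun g _ => mem_Inn g, ?_, ?_⟩
  · rintro _ ⟨g, hg, rfl⟩ _ ⟨h, hh, rfl⟩
    rw [← map_mul, ← map_mul, hG.comm g hg h hh]
  · rintro _ ⟨g, hg, rfl⟩
    refine isDiag_iff.2 (isSemisimple_of_surjective (isDiag_iff.1 (hG.diag g hg))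
      φ.toLinearMap φ.surjective fun x => ?_)
    change φ (g x) = φ (g (φ.symm (φ x)))
    rw [AlgEquiv.symm_apply_apply]

/-- `G` contains every automorphism which commutes with all elements of `G`. -/
def IsSelfCentralizing (G : Subgroup (AutMat a)) : Prop :=
  ∀ g : AutMat a, (∀ h ∈ G, g * h = h * g) → g ∈ G

theorem AutEquiv.isSelfCentralizing {G : Subgroup (AutMat a)} {H : Subgroup (AutMat b)}
    (h : AutEquiv G H) (hG : IsSelfCentralizing G) : IsSelfCentralizing H := by
  obtain ⟨φ, rfl⟩ := h
  intro g hg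
  rw [Subgroup.mem_map_equiv]
  refine hG _ fun h hh => ?_
  apply (AlgEquiv.autCongr φ).injective
  rw [map_mul, map_mul, MulEquiv.apply_symm_apply]
  exact hg _ ⟨h, hh, rfl⟩

/-- An abelian overgroup centralizes `G`. Unlike maximality, being self-centralizing passes easily
to tensor products with Pauli groups. -/
theorem IsSelfCentralizing.isMAD {G : Subgroup (AutMat a)} (h : IsSelfCentralizing G)
    (hG : IsAbelianDiagInner G) : IsMAD G :=
  ⟨hG, fun _ hH hle g hg => h g fun k hk => hH.comm g hg k (hle hk)⟩

end AutEquiv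

/-! ### Tensor products of automorphism groups -/

section Tensor

variable {a b c a' b' : ℕ}

theorem kron_induction {p : Mat (a * b) → Prop} (hk : ∀ X Y, p (kron a b (X ⊗ₜ Y)))
    (hadd : ∀ x y, p x → p y → p (x + y)) (x : Mat (a * b)) : p x := by
  obtain ⟨t, rfl⟩ := (kron a b).surjective x
  induction t using TensorProduct.induction_on with
  | zero => simpa using hk 0 0
  | tmul X Y => exact hk X Y
  | add x y hx hy => rw [map_add]; exact hadd _ _ hx hy

theorem kron_mul (X X' : Mat a) (Y Y' : Mat b) :
    kron a b (X ⊗ₜ Y) * kron a b (X' ⊗ₜ Y') = kron a b ((X * X') ⊗ₜ (Y * Y')) := by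
  rw [← map_mul, Algebra.TensorProduct.tmul_mul_tmul]

theorem kron_one : kron a b (1 ⊗ₜ 1) = 1 := map_one (kron a b)

theorem kron_smul (r : ℂ) (X : Mat a) (Y : Mat b) :
    kron a b ((r • X) ⊗ₜ Y) = r • kron a b (X ⊗ₜ Y) := by
  rw [← TensorProduct.smul_tmul', map_smul]

theorem kron_pow (X : Mat a) (Y : Mat b) (k : ℕ) :
    kron a b (X ⊗ₜ Y) ^ k = kron a b ((X ^ k) ⊗ₜ (Y ^ k)) := by
  rw [← map_pow, Algebra.TensorProduct.tmul_pow]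

theorem kron_tmul_apply (X : Mat a) (Y : Mat b) (i j : Fin a) (s t : Fin b) :
    kron a b (X ⊗ₜ Y) (finProdFinEquiv (i, s)) (finProdFinEquiv (j, t)) = X i j * Y s t := by
  rw [kron_tmul]
  simp [-finProdFinEquiv_apply_val]

theorem kron_one_injective (ha : a ≠ 0) :
    Function.Injective fun Y : Mat b => kron a b (1 ⊗ₜ Y) := by
  intro Y Y' h
  ext s t
  let i : Fin a := ⟨0, Nat.pos_of_ne_zero ha⟩
  have := congrFun (congrFun h (finProdFinEquiv (i, s))) (finProdFinEquiv (i, t))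
  simpa [kron_tmul_apply] using this

theorem kron_tmul_one_injective (hb : b ≠ 0) :
    Function.Injective fun X : Mat a => kron a b (X ⊗ₜ 1) := by
  intro X X' h
  ext i j
  let s : Fin b := ⟨0, Nat.pos_of_ne_zero hb⟩
  have := congrFun (congrFun h (finProdFinEquiv (i, s))) (finProdFinEquiv (j, s))
  simpa [kron_tmul_apply] using this

theorem tensorAut_injective (ha : a ≠ 0) (hb : b ≠ 0) : Function.Injective (tensorAut a b) := by
  rintro ⟨g, h⟩ ⟨g', h'⟩ heq
  refine Prod.ext (AlgEquiv.ext fun X => ?_) (AlgEquiv.ext fun Y => ?_)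
  · apply kron_tmul_one_injective hb
    have := AlgEquiv.congr_fun heq (kron a b (X ⊗ₜ 1))
    simpa only [tensorAut_kron, map_one] using this
  · apply kron_one_injective ha
    have := AlgEquiv.congr_fun heq (kron a b (1 ⊗ₜ Y))
    simpa only [tensorAut_kron, map_one] using this

theorem AutEquiv.tensorGroup {G : Subgroup (AutMat a)} {G' : Subgroup (AutMat a')}
    {H : Subgroup (AutMat b)} {H' : Subgroup (AutMat b')} (h : AutEquiv G G')
    (h' : AutEquiv H H') : AutEquiv (tensorGroup G H) (tensorGroup G' H') := by
  obtain ⟨φ, rfl⟩ := h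
  obtain ⟨ψ, rfl⟩ := h'
  let θ : Mat (a * b) ≃ₐ[ℂ] Mat (a' * b') :=
    (kron a b).symm.trans ((Algebra.TensorProduct.congr φ ψ).trans (kron a' b'))
  have hθ (X : Mat a) (Y : Mat b) : θ (kron a b (X ⊗ₜ Y)) = kron a' b' (φ X ⊗ₜ ψ Y) := by
    simp [θ]
  clear_value θ
  refine ⟨θ, ?_⟩
  have key (g : AutMat a) (h : AutMat b) : tensorAut a' b' (AlgEquiv.autCongr φ g,
      AlgEquiv.autCongr ψ h) = AlgEquiv.autCongr θ (tensorAut a b (g, h)) := by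
    ext1 x
    obtain ⟨x, rfl⟩ := θ.surjective x
    change _ = θ (tensorAut a b (g, h) (θ.symm (θ x)))
    rw [AlgEquiv.symm_apply_apply]
    induction x using kron_induction with
    | hk X Y =>
      rw [hθ, tensorAut_kron, tensorAut_kron, hθ]
      change kron a' b' (φ (g (φ.symm (φ X))) ⊗ₜ ψ (h (ψ.symm (ψ Y)))) = _
      rw [AlgEquiv.symm_apply_apply, AlgEquiv.symm_apply_apply]
    | hadd x y hx hy => simp only [map_add, hx, hy]
  ext g
  constructor
  · rintro ⟨⟨_, _⟩, ⟨⟨g, hg, rfl⟩, ⟨h, hh, rfl⟩⟩, rfl⟩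
    exact ⟨_, ⟨(g, h), ⟨hg, hh⟩, rfl⟩, (key g h).symm⟩
  · rintro ⟨_, ⟨⟨g, h⟩, ⟨hg, hh⟩, rfl⟩, rfl⟩
    exact ⟨_, ⟨⟨g, hg, rfl⟩, ⟨h, hh, rfl⟩⟩, key g h⟩

/-- This exchanges two adjacent Pauli factors of a standard group. -/
theorem autEquiv_tensorGroup_left_comm (G : Subgroup (AutMat a)) (H : Subgroup (AutMat b))
    (K : Subgroup (AutMat c)) :
    AutEquiv (tensorGroup G (tensorGroup H K)) (tensorGroup H (tensorGroup G K)) := by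
  let θ : Mat (a * (b * c)) ≃ₐ[ℂ] Mat (b * (a * c)) :=
    (kron a (b * c)).symm.trans <|
      (Algebra.TensorProduct.congr AlgEquiv.refl (kron b c).symm).trans <|
        (Algebra.TensorProduct.leftComm ℂ (Mat a) (Mat b) (Mat c)).trans <|
          (Algebra.TensorProduct.congr AlgEquiv.refl (kron a c)).trans (kron b (a * c))
  have hθ (X : Mat a) (Y : Mat b) (Z : Mat c) :
      θ (kron a (b * c) (X ⊗ₜ kron b c (Y ⊗ₜ Z))) = kron b (a * c) (Y ⊗ₜ kron a c (X ⊗ₜ Z)) := by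
    simp [θ]
  clear_value θ
  refine ⟨θ, ?_⟩
  have key (g : AutMat a) (h : AutMat b) (k : AutMat c) :
      tensorAut b (a * c) (h, tensorAut a c (g, k)) =
        AlgEquiv.autCongr θ (tensorAut a (b * c) (g, tensorAut b c (h, k))) := by
    ext1 x
    obtain ⟨x, rfl⟩ := θ.surjective x
    change _ = θ (tensorAut a (b * c) (g, tensorAut b c (h, k)) (θ.symm (θ x)))
    rw [AlgEquiv.symm_apply_apply]
    induction x using kron_induction with
    | hk X W =>
      induction W using kron_induction with
      | hk Y Z => rw [hθ]; simp only [tensorAut_kron, hθ]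
      | hadd x y hx hy => simp only [TensorProduct.tmul_add, map_add, hx, hy]
    | hadd x y hx hy => simp only [map_add, hx, hy]
  ext g
  constructor
  · rintro ⟨⟨h, _⟩, ⟨hh, ⟨⟨g, k⟩, ⟨hg, hk⟩, rfl⟩⟩, rfl⟩
    exact ⟨_, ⟨_, ⟨hg, ⟨_, ⟨hh, hk⟩, rfl⟩⟩, rfl⟩, (key g h k).symm⟩
  · rintro ⟨_, ⟨⟨g, _⟩, ⟨hg, ⟨⟨h, k⟩, ⟨hh, hk⟩, rfl⟩⟩, rfl⟩, rfl⟩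
    exact ⟨_, ⟨hh, ⟨_, ⟨hg, hk⟩, rfl⟩⟩, key g h k⟩

/-- Tensor products of eigenvectors are eigenvectors, and they span. -/
theorem IsDiag.tensorAut {g : AutMat a} {h : AutMat b} (hg : IsDiag g) (hh : IsDiag h) :
    IsDiag (tensorAut a b (g, h)) := by
  unfold IsDiag
  rw [eq_top_iff]
  rintro x -
  induction x using kron_induction with
  | hk X Y =>
    have hX : X ∈ ⨆ μ : ℂ, Module.End.eigenspace (g.toLinearMap : Module.End ℂ (Mat a)) μ := by
      rw [hg]; trivial
    have hY : Y ∈ ⨆ μ : ℂ, Module.End.eigenspace (h.toLinearMap : Module.End ℂ (Mat b)) μ := by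
      rw [hh]; trivial
    induction hX using Submodule.iSup_induction' with
    | zero => simp
    | add x y _ _ hx hy => rw [TensorProduct.add_tmul, map_add]; exact add_mem hx hy
    | mem μ X hX =>
      induction hY using Submodule.iSup_induction' with
      | zero => simp
      | add x y _ _ hx hy => rw [TensorProduct.tmul_add, map_add]; exact add_mem hx hy
      | mem ν Y hY =>
        refine le_iSup (fun μ => Module.End.eigenspace _ μ) (μ * ν) ?_
        rw [Module.End.mem_eigenspace_iff] at *
        change g X = _ at hX
        change h Y = _ at hY
        change PauliMAD.tensorAut a b (g, h) _ = _
        rw [tensorAut_kron, hX, hY, TensorProduct.smul_tmul_smul, map_smul]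
  | hadd x y hx hy => exact add_mem hx hy

theorem IsAbelianDiagInner.tensorGroup {G : Subgroup (AutMat a)} {H : Subgroup (AutMat b)}
    (hG : IsAbelianDiagInner G) (hH : IsAbelianDiagInner H) :
    IsAbelianDiagInner (tensorGroup G H) := by
  refine ⟨fun g _ => mem_Inn g, ?_, ?_⟩
  · rintro _ ⟨⟨g, h⟩, ⟨hg, hh⟩, rfl⟩ _ ⟨⟨g', h'⟩, ⟨hg', hh'⟩, rfl⟩
    rw [← map_mul, ← map_mul]
    exact congrArg _ (Prod.ext (hG.comm g hg g' hg') (hH.comm h hh h' hh'))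
  · rintro _ ⟨⟨g, h⟩, ⟨hg, hh⟩, rfl⟩
    exact (hG.diag g hg).tensorAut (hH.diag h hh)

end Tensor

/-! ### Commuting automorphisms and the scalars between lifts -/

section Basic

variable {n : ℕ}

/-- It follows that an eigenvalue belonging to an invertible eigenvector is an `n`-th root of unity.
-/
theorem det_aut (g : AutMat n) (X : Mat n) : (g X).det = X.det := by
  obtain ⟨A, rfl⟩ := Ad_surjective g
  rw [Ad_apply, Matrix.det_mul, Matrix.det_mul, mul_right_comm, ← Matrix.det_mul, Units.mul_inv,
    Matrix.det_one, one_mul]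

theorem exists_smul_of_Ad_eq_one {A : GL (Fin n) ℂ} (h : Ad n A = 1) :
    ∃ c : ℂ, (A : Mat n) = c • 1 := by
  have : (A : Mat n) ∈ Set.range (Matrix.scalar (Fin n)) := by
    rw [Matrix.mem_range_scalar_iff_commute_single']
    intro i j
    have := AlgEquiv.congr_fun h (Matrix.single i j 1)
    rw [Ad_apply] at this
    change _ = Matrix.single i j (1 : ℂ) at this
    change Matrix.single i j (1 : ℂ) * (A : Mat n) = (A : Mat n) * Matrix.single i j (1 : ℂ)
    conv_lhs => rw [← this]
    rw [mul_assoc, Units.inv_mul, mul_one]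
  obtain ⟨c, hc⟩ := this
  exact ⟨c, by rw [← hc, Matrix.scalar_apply, Matrix.smul_one_eq_diagonal]⟩

/-- If `g` commutes with `Ad_B`, then `B` is an eigenvector of `g`. -/
theorem exists_apply_eq_smul {g : AutMat n} {B : GL (Fin n) ℂ} (h : g * Ad n B = Ad n B * g) :
    ∃ c : ℂ, g B = c • (B : Mat n) := by
  obtain ⟨A, rfl⟩ := Ad_surjective g
  -- The commutator of the lifts acts trivially, so it is central.
  obtain ⟨c, hc⟩ := exists_smul_of_Ad_eq_one (A := A * B * A⁻¹ * B⁻¹) (by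
    rw [map_mul, map_mul, map_mul, h, map_inv, map_inv]
    group)
  refine ⟨c, ?_⟩
  have : ((A * B * A⁻¹ : GL (Fin n) ℂ) : Mat n) = c • (B : Mat n) := by
    rw [show A * B * A⁻¹ = A * B * A⁻¹ * B⁻¹ * B by group, Units.val_mul, hc, smul_mul_assoc,
      one_mul]
  exact this

theorem Ad_apply_eq_smul_iff {A B : GL (Fin n) ℂ} {c : ℂ} :
    Ad n A B = c • (B : Mat n) ↔ (A : Mat n) * B = c • ((B : Mat n) * A) := by
  rw [Ad_apply]
  constructor
  · intro h
    rw [← smul_mul_assoc, ← h, mul_assoc, Units.inv_mul, mul_one]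
  · intro h
    rw [h, smul_mul_assoc, mul_assoc, Units.mul_inv, mul_one]

theorem pow_apply_eq_smul {g : AutMat n} {B : Mat n} {c : ℂ} (h : g B = c • B) (k : ℕ) :
    (g ^ k) B = c ^ k • B := by
  induction k with
  | zero => simp
  | succ k ih => rw [pow_succ, AlgEquiv.mul_apply, h, map_smul, ih, smul_smul, pow_succ, mul_comm]

theorem inv_apply_eq_smul {g : AutMat n} {B : Mat n} {c : ℂ} (h : g B = c • B) (hc : c ≠ 0) :
    g⁻¹ B = c⁻¹ • B := by
  apply g.injective
  change g (g.symm B) = _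
  rw [AlgEquiv.apply_symm_apply, map_smul, h, smul_smul, inv_mul_cancel₀ hc, one_smul]

end Basic

/-! ### The diagonal group -/

section Diagonal

variable {n : ℕ}

theorem D_isAbelianDiagInner : IsAbelianDiagInner (D n) := by
  refine ⟨fun g _ => mem_Inn g, ?_, ?_⟩
  · rintro _ ⟨d, rfl⟩ _ ⟨e, rfl⟩
    rw [← map_mul, ← map_mul, mul_comm]
  · rintro _ ⟨d, rfl⟩
    unfold IsDiag
    rw [eq_top_iff]
    rintro X -
    rw [Matrix.matrix_eq_sum_single X]
    refine sum_mem fun i _ => sum_mem fun j _ => ?_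
    refine le_iSup (fun μ => Module.End.eigenspace _ μ) ((d i : ℂ) * (d j : ℂ)⁻¹) ?_
    rw [Module.End.mem_eigenspace_iff]
    change Ad n (diagGL n d) _ = _
    rw [Ad_apply, ← map_inv, diagGL_val, diagGL_val]
    ext k l
    rw [Matrix.mul_diagonal, Matrix.diagonal_mul, Matrix.smul_apply, Matrix.single_apply]
    split_ifs with h
    · obtain ⟨rfl, rfl⟩ := h
      simp only [Pi.inv_apply, Units.val_inv_eq_inv_val, smul_eq_mul]
      ring
    · simp

/-- A centralizing automorphism scales a diagonal matrix by an `n`-th root of unity, so it fixes the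
`n`-th power. When that power has distinct entries, the lift must be diagonal. -/
theorem D_isSelfCentralizing : IsSelfCentralizing (D n) := by
  intro g hg
  obtain rfl | hn := Nat.eq_zero_or_pos n
  · rw [show g = 1 by ext x i; exact i.elim0]
    exact one_mem _
  have : Nonempty (Fin n) := ⟨⟨0, hn⟩⟩
  obtain ⟨B, rfl⟩ := Ad_surjective g
  -- Powers of 2 remain pairwise distinct after raising to the `n`-th power.
  let e : Fin n → ℂˣ := fun i => (Units.mk0 (2 : ℂ) two_ne_zero) ^ (i : ℕ)
  obtain ⟨c, hc⟩ := exists_apply_eq_smul (B := diagGL n e) (hg _ ⟨e, rfl⟩)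
  have hcn : c ^ n = 1 := by
    have h := det_aut (Ad n B) (diagGL n e)
    rw [hc, Matrix.det_smul, Fintype.card_fin] at h
    have h0 : (diagGL n e : Mat n).det ≠ 0 :=
      ((Matrix.isUnit_iff_isUnit_det _).1 (diagGL n e).isUnit).ne_zero
    exact mul_right_cancel₀ h0 (by rw [h, one_mul])
  have hfix : Ad n B ((diagGL n e : Mat n) ^ n) = (1 : ℂ) • ((diagGL n e : Mat n) ^ n) := by
    rw [map_pow, hc, smul_pow, hcn]
  have hcomm : (B : Mat n) * (diagGL n e : Mat n) ^ n = (diagGL n e : Mat n) ^ n * B := by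
    rw [← Units.val_pow_eq_pow_val, Ad_apply_eq_smul_iff, one_smul] at hfix
    rwa [← Units.val_pow_eq_pow_val]
  have hoff (i j : Fin n) (hij : i ≠ j) : (B : Mat n) i j = 0 := by
    have h := congrFun (congrFun hcomm i) j
    rw [diagGL_val, Matrix.diagonal_pow, Matrix.mul_diagonal, Matrix.diagonal_mul] at h
    by_contra h0
    rw [mul_comm] at h
    have h1 := mul_right_cancel₀ h0 h
    simp only [e, Pi.pow_apply, Units.val_pow_eq_pow_val, Units.val_mk0, ← pow_mul] at h1
    have h2 : (2 : ℕ) ^ ((j : ℕ) * n) = 2 ^ ((i : ℕ) * n) := by exact_mod_cast h1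
    have h3 := Nat.pow_right_injective le_rfl h2
    exact hij (Fin.ext (Nat.eq_of_mul_eq_mul_right hn h3).symm)
  have hdiag (i : Fin n) : (B : Mat n) i i ≠ 0 := by
    intro h0
    have h := congrFun (congrFun B.mul_inv i) i
    rw [Matrix.mul_apply, Finset.sum_eq_zero, Matrix.one_apply_eq] at h
    · exact zero_ne_one h
    · intro j _
      by_cases hij : i = j
      · rw [← hij, h0, zero_mul]
      · rw [hoff i j hij, zero_mul]
  refine ⟨fun i => Units.mk0 _ (hdiag i), ?_⟩
  rw [MonoidHom.comp_apply]
  congr 1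
  ext i j
  rw [diagGL_val, Matrix.diagonal_apply]
  split_ifs with h
  · rw [h]; rfl
  · exact (hoff i j h).symm

end Diagonal

/-! ### The Pauli group -/

section Pauli

variable {n : ℕ}

theorem omega_isPrimitiveRoot (hn : n ≠ 0) : IsPrimitiveRoot (omega n : ℂ) n :=
  Complex.isPrimitiveRoot_exp n hn

theorem omega_ne_zero : (omega n : ℂ) ≠ 0 := (omega n).ne_zero

theorem Q_pow (n : ℕ) : Q n ^ n = 1 := by
  rw [Q, ← map_pow, ← map_one (diagGL n)]
  congr 1
  ext1 k
  rw [Pi.pow_apply, ← pow_mul, mul_comm, pow_mul, omega_pow, one_pow, Pi.one_apply]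

theorem P_apply_finRotate (ρ σ : Fin n) :
    (P n : Mat n) ρ σ = if finRotate n ρ = σ then 1 else 0 := rfl

theorem P_pow_apply (k : ℕ) (ρ σ : Fin n) :
    ((P n : Mat n) ^ k) ρ σ = if (finRotate n ^ k) ρ = σ then 1 else 0 := by
  induction k generalizing ρ with
  | zero => simp [Matrix.one_apply]
  | succ k ih =>
    rw [pow_succ', Matrix.mul_apply]
    simp only [ih, P_apply_finRotate, ite_mul, one_mul, zero_mul]
    rw [Finset.sum_ite_eq, if_pos (Finset.mem_univ _), pow_succ, Equiv.Perm.mul_apply]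

theorem finRotate_pow_self (n : ℕ) : finRotate n ^ n = 1 := by
  obtain _ | n := n
  · rfl
  have h (k : ℕ) (i : Fin (n + 1)) : (finRotate (n + 1) ^ k) i = i + Fin.ofNat (n + 1) k := by
    induction k with
    | zero => simp
    | succ k ih =>
      rw [pow_succ', Equiv.Perm.mul_apply, ih, finRotate_apply]
      ext
      simp [Fin.val_add, add_assoc]
  ext i
  rw [h]
  simp

theorem P_pow (n : ℕ) : P n ^ n = 1 := by
  ext i j
  rw [Units.val_pow_eq_pow_val, P_pow_apply, finRotate_pow_self]
  exact if_congr Iff.rfl rfl rfl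

theorem Ad_P_Q (n : ℕ) : Ad n (P n) (Q n) = (omega n : ℂ) • (Q n : Mat n) :=
  Ad_apply_eq_smul_iff.2 (P_mul_Q n)

theorem Ad_Q_P (n : ℕ) : Ad n (Q n) (P n) = (omega n : ℂ)⁻¹ • (P n : Mat n) := by
  rw [Ad_apply_eq_smul_iff, P_mul_Q, smul_smul, inv_mul_cancel₀ omega_ne_zero, one_smul]

theorem Ad_Q_Q (n : ℕ) : Ad n (Q n) (Q n) = (Q n : Mat n) := by
  rw [Ad_apply, mul_assoc, Units.mul_inv, mul_one]

theorem Ad_P_P (n : ℕ) : Ad n (P n) (P n) = (P n : Mat n) := by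
  rw [Ad_apply, mul_assoc, Units.mul_inv, mul_one]

theorem Ad_Q_mem_pauli (n : ℕ) : Ad n (Q n) ∈ pauli n := ⟨1, 0, by simp⟩

theorem Ad_P_mem_pauli (n : ℕ) : Ad n (P n) ∈ pauli n := ⟨0, 1, by simp⟩

theorem mem_pauli_iff {g : AutMat n} :
    g ∈ pauli n ↔ ∃ i j : ℤ, g = Ad n (Q n) ^ i * Ad n (P n) ^ j := by
  change (∃ i j : ℤ, g = Ad n (Q n ^ i * P n ^ j)) ↔ _
  simp only [map_mul, map_zpow]

theorem pauli_isAbelianDiagInner (hn : n ≠ 0) : IsAbelianDiagInner (pauli n) := by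
  have hcomm := Ad_Q_commute_Ad_P n
  refine ⟨fun g _ => mem_Inn g, ?_, ?_⟩
  · intro g hg h hh
    obtain ⟨i, j, rfl⟩ := mem_pauli_iff.1 hg
    obtain ⟨k, l, rfl⟩ := mem_pauli_iff.1 hh
    refine (Commute.mul_left (Commute.mul_right ?_ ?_) (Commute.mul_right ?_ ?_)).eq
    · exact (Commute.refl _).zpow_zpow i k
    · exact hcomm.zpow_zpow i l
    · exact hcomm.symm.zpow_zpow j k
    · exact (Commute.refl _).zpow_zpow j l
  · intro g hg
    obtain ⟨i, j, rfl⟩ := mem_pauli_iff.1 hg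
    refine isDiag_of_pow_eq_one hn ?_
    have hQ : Ad n (Q n) ^ n = 1 := by rw [← map_pow, Q_pow, map_one]
    have hP : Ad n (P n) ^ n = 1 := by rw [← map_pow, P_pow, map_one]
    rw [(hcomm.zpow_zpow i j).mul_pow, ← zpow_natCast, ← zpow_natCast, zpow_comm _ i, zpow_comm _ j,
      zpow_natCast, zpow_natCast, hQ, hP, one_zpow, one_zpow, one_mul]

end Pauli

/-! ### Commutants and centralizers of Pauli factors -/

section Commutant

variable {a b : ℕ}

theorem mul_kron_one_apply (M : Mat (a * b)) (X : Mat a) (i j : Fin a) (s t : Fin b) :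
    (M * kron a b (X ⊗ₜ 1)) (finProdFinEquiv (i, s)) (finProdFinEquiv (j, t)) =
      ∑ k, M (finProdFinEquiv (i, s)) (finProdFinEquiv (k, t)) * X k j := by
  rw [Matrix.mul_apply, ← Equiv.sum_comp finProdFinEquiv, Fintype.sum_prod_type]
  simp [kron_tmul_apply, Matrix.one_apply, -finProdFinEquiv_apply_val]

theorem kron_one_mul_apply (M : Mat (a * b)) (X : Mat a) (i j : Fin a) (s t : Fin b) :
    (kron a b (X ⊗ₜ 1) * M) (finProdFinEquiv (i, s)) (finProdFinEquiv (j, t)) =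
      ∑ k, X i k * M (finProdFinEquiv (k, s)) (finProdFinEquiv (j, t)) := by
  rw [Matrix.mul_apply, ← Equiv.sum_comp finProdFinEquiv, Fintype.sum_prod_type]
  simp [kron_tmul_apply, Matrix.one_apply, -finProdFinEquiv_apply_val]

/-- The commutant of `Q ⊗ 1` and `P ⊗ 1` is `1 ⊗ M_b(ℂ)`. -/
theorem exists_eq_kron_one (ha : a ≠ 0) {M : Mat (a * b)}
    (hQ : M * kron a b ((Q a : Mat a) ⊗ₜ 1) = kron a b ((Q a : Mat a) ⊗ₜ 1) * M)
    (hP : M * kron a b ((P a : Mat a) ⊗ₜ 1) = kron a b ((P a : Mat a) ⊗ₜ 1) * M) :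
    ∃ C : Mat b, M = kron a b (1 ⊗ₜ C) := by
  obtain ⟨a, rfl⟩ := Nat.exists_eq_succ_of_ne_zero ha
  -- Commuting with `Q ⊗ 1` kills off-diagonal blocks, since the powers of `ω` are distinct.
  have hoff (i j : Fin (a + 1)) (s t : Fin b) (hij : i ≠ j) :
      M (finProdFinEquiv (i, s)) (finProdFinEquiv (j, t)) = 0 := by
    have h := congrFun (congrFun hQ (finProdFinEquiv (i, s))) (finProdFinEquiv (j, t))
    rw [mul_kron_one_apply, kron_one_mul_apply] at h
    simp only [Q, diagGL_val, Matrix.diagonal_apply, mul_ite, ite_mul, mul_zero, zero_mul,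
      Finset.sum_ite_eq, Finset.sum_ite_eq', Finset.mem_univ, if_true] at h
    by_contra h0
    rw [mul_comm] at h
    have h1 := mul_right_cancel₀ h0 h
    rw [Units.val_pow_eq_pow_val, Units.val_pow_eq_pow_val] at h1
    exact hij (Fin.ext ((omega_isPrimitiveRoot ha).pow_inj j.2 i.2 h1).symm)
  -- Commuting with `P ⊗ 1` identifies consecutive diagonal blocks.
  have hshift (i : Fin (a + 1)) (s t : Fin b) :
      M (finProdFinEquiv (finRotate _ i, s)) (finProdFinEquiv (finRotate _ i, t)) =
        M (finProdFinEquiv (i, s)) (finProdFinEquiv (i, t)) := by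
    have h := congrFun (congrFun hP (finProdFinEquiv (i, s)))
      (finProdFinEquiv (finRotate _ i, t))
    rw [mul_kron_one_apply, kron_one_mul_apply] at h
    simp only [P_apply_finRotate, EmbeddingLike.apply_eq_iff_eq, mul_ite, ite_mul, mul_one,
      one_mul, mul_zero, zero_mul, Finset.sum_ite_eq, Finset.sum_ite_eq', Finset.mem_univ,
      if_true] at h
    exact h.symm
  have hconst (i : Fin (a + 1)) (s t : Fin b) :
      M (finProdFinEquiv (i, s)) (finProdFinEquiv (i, t)) =
        M (finProdFinEquiv (0, s)) (finProdFinEquiv (0, t)) := by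
    induction i using Fin.induction with
    | zero => rfl
    | succ i ih =>
      rw [← ih, ← hshift i.castSucc, finRotate_apply, Fin.coeSucc_eq_succ]
  refine ⟨Matrix.of fun s t => M (finProdFinEquiv (0, s)) (finProdFinEquiv (0, t)), ?_⟩
  ext x y
  obtain ⟨⟨i, s⟩, rfl⟩ := finProdFinEquiv.surjective x
  obtain ⟨⟨j, t⟩, rfl⟩ := finProdFinEquiv.surjective y
  rw [kron_tmul_apply, Matrix.one_apply]
  split_ifs with h
  · subst h
    rw [hconst, one_mul]
    rfl
  · rw [hoff i j s t h, zero_mul]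

theorem Ad_fixes_iff {n : ℕ} {B : GL (Fin n) ℂ} {X : Mat n} :
    Ad n B X = X ↔ (B : Mat n) * X = X * B := by
  rw [Ad_apply]
  constructor
  · intro h
    conv_rhs => rw [← h]
    rw [mul_assoc _ _ (B : Mat n), Units.inv_mul, mul_one]
  · intro h
    rw [h, mul_assoc, Units.mul_inv, mul_one]

/-- A lift and its inverse both lie in the commutant `1 ⊗ M_b(ℂ)`, so the lift is `1 ⊗ C` with `C`
invertible. -/
theorem exists_eq_tensorAut_one (ha : a ≠ 0) {g : AutMat (a * b)}
    (hQ : g (kron a b ((Q a : Mat a) ⊗ₜ 1)) = kron a b ((Q a : Mat a) ⊗ₜ 1))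
    (hP : g (kron a b ((P a : Mat a) ⊗ₜ 1)) = kron a b ((P a : Mat a) ⊗ₜ 1)) :
    ∃ k : AutMat b, g = tensorAut a b (1, k) := by
  obtain ⟨B, rfl⟩ := Ad_surjective g
  have hfix (X : Mat (a * b)) (h : Ad _ B X = X) : Ad _ B⁻¹ X = X := by
    rw [map_inv]
    exact (AlgEquiv.symm_apply_eq _).2 h.symm
  obtain ⟨C, hC⟩ := exists_eq_kron_one ha (Ad_fixes_iff.1 hQ) (Ad_fixes_iff.1 hP)
  obtain ⟨C', hC'⟩ := exists_eq_kron_one ha (Ad_fixes_iff.1 (hfix _ hQ))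
    (Ad_fixes_iff.1 (hfix _ hP))
  have h1 : C * C' = 1 := by
    apply kron_one_injective ha
    change kron a b (1 ⊗ₜ (C * C')) = kron a b (1 ⊗ₜ 1)
    rw [← one_mul (1 : Mat a), ← kron_mul, one_mul, ← hC, ← hC', Units.mul_inv, kron_one]
  have h2 : C' * C = 1 := by
    apply kron_one_injective ha
    change kron a b (1 ⊗ₜ (C' * C)) = kron a b (1 ⊗ₜ 1)
    rw [← one_mul (1 : Mat a), ← kron_mul, one_mul, ← hC, ← hC', Units.inv_mul, kron_one]
  refine ⟨Ad b ⟨C, C', h1, h2⟩, ?_⟩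
  ext1 x
  induction x using kron_induction with
  | hk X Y =>
    rw [tensorAut_kron, Ad_apply, hC, hC', kron_mul, kron_mul, one_mul, mul_one]
    rfl
  | hadd x y hx hy => rw [map_add, map_add, hx, hy]

/-- An automorphism for which `Q ⊗ 1` and `P ⊗ 1` are eigenvectors is a tensor product of
an element of the Pauli group and an automorphism of the second factor. -/
theorem exists_eq_tensorAut (ha : a ≠ 0) {g : AutMat (a * b)} {c d : ℂ} (hc : c ^ a = 1)
    (hd : d ^ a = 1)
    (hQ : g (kron a b ((Q a : Mat a) ⊗ₜ 1)) = c • kron a b ((Q a : Mat a) ⊗ₜ 1))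
    (hP : g (kron a b ((P a : Mat a) ⊗ₜ 1)) = d • kron a b ((P a : Mat a) ⊗ₜ 1)) :
    ∃ t ∈ pauli a, ∃ k : AutMat b, g = tensorAut a b (t, k) := by
  have : NeZero a := ⟨ha⟩
  have hprim := omega_isPrimitiveRoot ha
  obtain ⟨i, -, rfl⟩ := hprim.eq_pow_of_pow_eq_one hc
  obtain ⟨j, -, rfl⟩ := hprim.eq_pow_of_pow_eq_one hd
  -- `Ad_P` scales `Q` by `ω` and fixes `P`; `Ad_Q` scales `P` by `ω⁻¹` and fixes `Q`. Hence `s`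
  -- cancels both scalars and `g * (s ⊗ 1)` fixes `Q ⊗ 1` and `P ⊗ 1`.
  let s : AutMat a := Ad a (Q a) ^ j * (Ad a (P a) ^ i)⁻¹
  have hs : s ∈ pauli a := mul_mem (pow_mem (Ad_Q_mem_pauli a) j)
    (inv_mem (pow_mem (Ad_P_mem_pauli a) i))
  have hsQ : s (Q a) = ((omega a : ℂ) ^ i)⁻¹ • (Q a : Mat a) := by
    rw [AlgEquiv.mul_apply, inv_apply_eq_smul (pow_apply_eq_smul (Ad_P_Q a) i)
      (pow_ne_zero _ omega_ne_zero), map_smul]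
    have := pow_apply_eq_smul (c := 1) (by rw [Ad_Q_Q, one_smul]) j (B := (Q a : Mat a))
      (g := Ad a (Q a))
    rw [this, one_pow, one_smul]
  have hsP : s (P a) = ((omega a : ℂ) ^ j)⁻¹ • (P a : Mat a) := by
    have := inv_apply_eq_smul (pow_apply_eq_smul (c := 1) (by rw [Ad_P_P, one_smul]) i
      (B := (P a : Mat a)) (g := Ad a (P a))) (by simp)
    rw [AlgEquiv.mul_apply, this, map_smul, pow_apply_eq_smul (Ad_Q_P a) j]
    simp
  obtain ⟨k, hk⟩ := exists_eq_tensorAut_one (g := g * tensorAut a b (s, 1)) ha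
    (by
      rw [AlgEquiv.mul_apply, tensorAut_kron, hsQ, kron_smul, map_smul, map_one, hQ, smul_smul,
        inv_mul_cancel₀ (pow_ne_zero _ omega_ne_zero), one_smul])
    (by
      rw [AlgEquiv.mul_apply, tensorAut_kron, hsP, kron_smul, map_smul, map_one, hP, smul_smul,
        inv_mul_cancel₀ (pow_ne_zero _ omega_ne_zero), one_smul])
  refine ⟨s⁻¹, inv_mem hs, k, ?_⟩
  rw [← mul_inv_eq_iff_eq_mul.2 hk.symm, ← map_inv, ← map_mul]
  simp

theorem pow_eq_one_of_apply_eq_smul {n k : ℕ} [NeZero n] {g : AutMat n} {X : Mat n} {c : ℂ}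
    (h : g X = c • X) (hX : X ^ k = 1) : c ^ k = 1 := by
  have := congrArg g hX
  rw [map_pow, h, smul_pow, hX, map_one] at this
  simpa using congrFun (congrFun this 0) 0

/-- Commuting with `𝒫_a ⊗ 1` makes `Q ⊗ 1` and `P ⊗ 1` eigenvectors, so `g = t ⊗ k` with `t` in
`𝒫_a`; commuting with `1 ⊗ H` then puts `k` into `H`. -/
theorem isSelfCentralizing_tensorGroup_pauli (ha : a ≠ 0) (hb : b ≠ 0) {H : Subgroup (AutMat b)}
    (hH : IsSelfCentralizing H) : IsSelfCentralizing (tensorGroup (pauli a) H) := by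
  intro g hg
  have : NeZero (a * b) := ⟨mul_ne_zero ha hb⟩
  have hT (T : GL (Fin a) ℂ) (hT : Ad a T ∈ pauli a) (hTa : T ^ a = 1) :
      ∃ c : ℂ, c ^ a = 1 ∧ g (kron a b ((T : Mat a) ⊗ₜ 1)) = c • kron a b ((T : Mat a) ⊗ₜ 1) := by
    let T' : GL (Fin (a * b)) ℂ := ⟨kron a b ((T : Mat a) ⊗ₜ 1),
      kron a b (((T⁻¹ : GL (Fin a) ℂ) : Mat a) ⊗ₜ 1),
      by rw [kron_mul, Units.mul_inv, one_mul, kron_one],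
      by rw [kron_mul, Units.inv_mul, one_mul, kron_one]⟩
    have hT' : tensorAut a b (Ad a T, 1) = Ad (a * b) T' := by
      ext1 x
      induction x using kron_induction with
      | hk X Y =>
        rw [tensorAut_kron, Ad_apply, Ad_apply]
        change _ = kron a b ((T : Mat a) ⊗ₜ 1) * kron a b (X ⊗ₜ Y) *
          kron a b (((T⁻¹ : GL (Fin a) ℂ) : Mat a) ⊗ₜ 1)
        rw [kron_mul, kron_mul, one_mul, mul_one]
        rfl
      | hadd x y hx hy => rw [map_add, map_add, hx, hy]
    obtain ⟨c, hc⟩ := exists_apply_eq_smul (g := g) (B := T')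
      (hT' ▸ hg _ ⟨(Ad a T, 1), ⟨hT, one_mem H⟩, rfl⟩)
    refine ⟨c, pow_eq_one_of_apply_eq_smul hc ?_, hc⟩
    change kron a b ((T : Mat a) ⊗ₜ 1) ^ a = 1
    rw [kron_pow, ← Units.val_pow_eq_pow_val, hTa, one_pow, Units.val_one, kron_one]
  obtain ⟨c, hc, hQ⟩ := hT (Q a) (Ad_Q_mem_pauli a) (Q_pow a)
  obtain ⟨d, hd, hP⟩ := hT (P a) (Ad_P_mem_pauli a) (P_pow a)
  obtain ⟨t, ht, k, rfl⟩ := exists_eq_tensorAut ha hc hd hQ hP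
  refine ⟨(t, k), ⟨ht, hH k fun h hh => ?_⟩, rfl⟩
  have := hg _ ⟨(1, h), ⟨one_mem _, hh⟩, rfl⟩
  rw [← map_mul, ← map_mul] at this
  exact congrArg Prod.snd (tensorAut_injective ha hb this)

end Commutant

/-! ### Standard groups are MAD-groups -/

section Standard

theorem autEquiv_pauliD_cons (n : ℕ) (L : List ℕ) (m : ℕ) :
    AutEquiv (tensorGroup (pauli n) (pauliD L m)) (pauliD (n :: L) m) :=
  autEquiv_castAut _ _

theorem autEquiv_pauliD_nil (m : ℕ) : AutEquiv (D m) (pauliD [] m) := autEquiv_castAut _ _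

theorem pauliD_isAbelianDiagInner {L : List ℕ} (hL : ∀ n ∈ L, n ≠ 0) (m : ℕ) :
    IsAbelianDiagInner (pauliD L m) := by
  induction L with
  | nil => exact (autEquiv_pauliD_nil m).isAbelianDiagInner D_isAbelianDiagInner
  | cons n L ih =>
    exact (autEquiv_pauliD_cons n L m).isAbelianDiagInner
      ((pauli_isAbelianDiagInner (hL n (by simp))).tensorGroup
        (ih fun k hk => hL k (List.mem_cons_of_mem n hk)))

theorem pauliD_isSelfCentralizing {L : List ℕ} (hL : ∀ n ∈ L, n ≠ 0) {m : ℕ} (hm : m ≠ 0) :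
    IsSelfCentralizing (pauliD L m) := by
  induction L with
  | nil => exact (autEquiv_pauliD_nil m).isSelfCentralizing D_isSelfCentralizing
  | cons n L ih =>
    have hL' : ∀ k ∈ L, k ≠ 0 := fun k hk => hL k (List.mem_cons_of_mem n hk)
    refine (autEquiv_pauliD_cons n L m).isSelfCentralizing
      (isSelfCentralizing_tensorGroup_pauli (hL n (by simp)) (mul_ne_zero ?_ hm) (ih hL'))
    rw [Ne, List.prod_eq_zero_iff]
    exact fun h => hL' 0 h rfl

theorem autEquiv_standard {N : ℕ} {L : List ℕ} {m : ℕ} (h : Admissible N L m) :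
    AutEquiv (pauliD L m) (standard L m h) := autEquiv_castAut _ _

theorem Admissible.ne_zero {N : ℕ} {L : List ℕ} {m : ℕ} (h : Admissible N L m) :
    ∀ n ∈ L, n ≠ 0 := fun n hn => (h.primePow n hn).ne_zero

theorem isMAD_standard {N : ℕ} (hN : N ≠ 0) {L : List ℕ} {m : ℕ} (h : Admissible N L m) :
    IsMAD (standard L m h) :=
  ((autEquiv_standard h).isSelfCentralizing (pauliD_isSelfCentralizing h.ne_zero
    (right_ne_zero_of_mul (h.prod_eq ▸ hN)))).isMAD
    ((autEquiv_standard h).isAbelianDiagInner (pauliD_isAbelianDiagInner h.ne_zero m))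

theorem autEquiv_pauliD_of_perm {L L' : List ℕ} (h : L.Perm L') (m : ℕ) :
    AutEquiv (pauliD L m) (pauliD L' m) := by
  induction h with
  | nil => exact AutEquiv.refl _
  | cons n _ ih =>
    exact (autEquiv_pauliD_cons n _ m).symm.trans
      (((AutEquiv.refl _).tensorGroup ih).trans (autEquiv_pauliD_cons n _ m))
  | swap k n L =>
    have h (k n : ℕ) : AutEquiv (tensorGroup (pauli k) (tensorGroup (pauli n) (pauliD L m)))
        (pauliD (k :: n :: L) m) :=
      ((AutEquiv.refl _).tensorGroup (autEquiv_pauliD_cons n L m)).trans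
        (autEquiv_pauliD_cons k _ m)
    exact (h n k).symm.trans ((autEquiv_tensorGroup_left_comm _ _ _).trans (h k n))
  | trans _ _ ih₁ ih₂ => exact ih₁.trans ih₂

end Standard

/-! ### Index of the subgroup of `k`-th powers -/

section PowIndex

/-- The index of the subgroup generated by the `k`-th powers. -/
def powIndex (G : Type*) [Group G] (k : ℕ) : ℕ :=
  (Subgroup.closure (Set.range fun x : G => x ^ k)).index

variable {G H : Type*} [Group G] [Group H]

theorem powIndex_congr (e : G ≃* H) (k : ℕ) : powIndex G k = powIndex H k := by
  unfold powIndex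
  rw [← Subgroup.index_map_equiv _ e, MonoidHom.map_closure]
  congr 2
  ext y
  constructor
  · rintro ⟨_, ⟨x, rfl⟩, rfl⟩
    exact ⟨e x, (map_pow e x k).symm⟩
  · rintro ⟨y, rfl⟩
    exact ⟨_, ⟨e.symm y, rfl⟩, by simp⟩

theorem powIndex_prod (k : ℕ) : powIndex (G × H) k = powIndex G k * powIndex H k := by
  unfold powIndex
  have hG : (1 : G) ∈ Set.range fun x : G => x ^ k := ⟨1, one_pow k⟩
  have hH : (1 : H) ∈ Set.range fun x : H => x ^ k := ⟨1, one_pow k⟩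
  rw [← Subgroup.index_prod, ← Subgroup.closure_prod hG hH, ← Set.range_prodMap]
  rfl

theorem powIndex_eq_one {k : ℕ} (h : ∀ x : G, ∃ y : G, y ^ k = x) : powIndex G k = 1 := by
  rw [powIndex, Subgroup.index_eq_one, eq_top_iff]
  exact fun x _ => Subgroup.subset_closure (h x)

theorem powIndex_zpowers {g : G} (hg : IsOfFinOrder g) (k : ℕ) :
    powIndex (Subgroup.zpowers g) k = (orderOf g).gcd k := by
  have : Finite (Subgroup.zpowers g) := (finite_zpowers.2 hg).to_subtype
  let _ : CommGroup (Subgroup.zpowers g) := IsCyclic.commGroup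
  have h := IsCyclic.index_powMonoidHom_range (G := Subgroup.zpowers g) k
  rw [Nat.card_zpowers] at h
  rw [← h]
  -- In a commutative group the `k`-th powers already form a subgroup.
  exact congrArg Subgroup.index
    (Subgroup.closure_eq (powMonoidHom k : Subgroup.zpowers g →* Subgroup.zpowers g).range)

end PowIndex

/-! ### Isomorphism invariants of standard groups -/

section Groups

variable {a b n : ℕ}

theorem AutEquiv.nonempty_mulEquiv {G : Subgroup (AutMat a)} {H : Subgroup (AutMat b)}
    (h : AutEquiv G H) : Nonempty (G ≃* H) := by
  obtain ⟨φ, rfl⟩ := h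
  exact ⟨Subgroup.equivMapOfInjective G _ (AlgEquiv.autCongr φ).injective⟩

theorem nonempty_mulEquiv_tensorGroup (ha : a ≠ 0) (hb : b ≠ 0) (G : Subgroup (AutMat a))
    (H : Subgroup (AutMat b)) : Nonempty (G × H ≃* tensorGroup G H) :=
  ⟨(Subgroup.prodEquiv G H).symm.trans
    (Subgroup.equivMapOfInjective _ _ (tensorAut_injective ha hb))⟩

theorem zpow_apply_eq_smul {g : AutMat n} {B : Mat n} {c : ℂ} (h : g B = c • B) (hc : c ≠ 0)
    (k : ℤ) : (g ^ k) B = c ^ k • B := by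
  cases k with
  | ofNat k => simpa using pow_apply_eq_smul h k
  | negSucc k =>
    rw [zpow_negSucc, zpow_negSucc]
    exact inv_apply_eq_smul (pow_apply_eq_smul h _) (pow_ne_zero _ hc)

theorem orderOf_of_apply_eq_smul {n : ℕ} [NeZero n] {g : AutMat n} {B : GL (Fin n) ℂ} {c : ℂ}
    (hg : g ^ n = 1) (h : g B = c • (B : Mat n)) (hc : IsPrimitiveRoot c n) :
    orderOf g = n := by
  refine Nat.dvd_antisymm (orderOf_dvd_of_pow_eq_one hg) (hc.dvd_of_pow_eq_one _ ?_)
  have := pow_apply_eq_smul h (orderOf g)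
  rw [pow_orderOf_eq_one, AlgEquiv.one_apply] at this
  have h' := congrArg (fun Y => Y * ((B⁻¹ : GL (Fin n) ℂ) : Mat n)) this
  simp only [smul_mul_assoc, Units.mul_inv] at h'
  simpa using (congrFun (congrFun h' 0) 0).symm

theorem Ad_Q_pow (n : ℕ) : Ad n (Q n) ^ n = 1 := by rw [← map_pow, Q_pow, map_one]

theorem Ad_P_pow (n : ℕ) : Ad n (P n) ^ n = 1 := by rw [← map_pow, P_pow, map_one]

theorem orderOf_Ad_Q [NeZero n] : orderOf (Ad n (Q n)) = n :=
  orderOf_of_apply_eq_smul (Ad_Q_pow n) (Ad_Q_P n) (omega_isPrimitiveRoot (NeZero.ne n)).inv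

theorem orderOf_Ad_P [NeZero n] : orderOf (Ad n (P n)) = n :=
  orderOf_of_apply_eq_smul (Ad_P_pow n) (Ad_P_Q n) (omega_isPrimitiveRoot (NeZero.ne n))

/-- The two cyclic groups meet trivially: a common element fixes `Q_n` as a power of `Ad_Q`, and
scales it by `ω^j` as `Ad_P ^ j`, so `n` divides `j`. -/
theorem nonempty_mulEquiv_pauli [NeZero n] :
    Nonempty (Subgroup.zpowers (Ad n (Q n)) × Subgroup.zpowers (Ad n (P n)) ≃* pauli n) := by
  let f : Subgroup.zpowers (Ad n (Q n)) × Subgroup.zpowers (Ad n (P n)) →* AutMat n :=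
    MonoidHom.noncommCoprod (Subgroup.subtype _) (Subgroup.subtype _) (by
      rintro ⟨_, i, rfl⟩ ⟨_, j, rfl⟩
      exact (Ad_Q_commute_Ad_P n).zpow_zpow i j)
  have hf : Function.Injective f := by
    rw [MonoidHom.noncommCoprod_injective]
    refine ⟨Subtype.val_injective, Subtype.val_injective, ?_⟩
    rw [Subgroup.range_subtype, Subgroup.range_subtype, Subgroup.disjoint_def]
    rintro _ ⟨i, rfl⟩ ⟨j, hj⟩
    change Ad n (P n) ^ j = Ad n (Q n) ^ i at hj
    have h1 := zpow_apply_eq_smul (Ad_P_Q n) omega_ne_zero j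
    have h2 := zpow_apply_eq_smul (g := Ad n (Q n)) (B := Q n) (c := 1)
      (by rw [Ad_Q_Q, one_smul]) one_ne_zero i
    rw [hj, h2, one_zpow, one_smul] at h1
    have h' := congrArg (fun Y => Y * (((Q n)⁻¹ : GL (Fin n) ℂ) : Mat n)) h1
    simp only [smul_mul_assoc, Units.mul_inv] at h'
    have h3 : (omega n : ℂ) ^ j = 1 := by simpa using (congrFun (congrFun h' 0) 0).symm
    obtain ⟨k, rfl⟩ := ((omega_isPrimitiveRoot (NeZero.ne n)).zpow_eq_one_iff_dvd j).1 h3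
    change Ad n (Q n) ^ i = 1
    rw [← hj, zpow_mul, zpow_natCast, Ad_P_pow, one_zpow]
  have hr : f.range = pauli n := by
    ext g
    rw [mem_pauli_iff]
    constructor
    · rintro ⟨⟨⟨_, i, rfl⟩, ⟨_, j, rfl⟩⟩, rfl⟩
      exact ⟨i, j, rfl⟩
    · rintro ⟨i, j, rfl⟩
      exact ⟨(⟨_, i, rfl⟩, ⟨_, j, rfl⟩), rfl⟩
  exact ⟨(MonoidHom.ofInjective hf).trans (MulEquiv.subgroupCongr hr)⟩

theorem powIndex_pauli [NeZero n] (k : ℕ) : powIndex (pauli n) k = n.gcd k ^ 2 := by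
  obtain ⟨e⟩ := nonempty_mulEquiv_pauli (n := n)
  have hn : 0 < n := NeZero.pos n
  rw [← powIndex_congr e, powIndex_prod,
    powIndex_zpowers (isOfFinOrder_iff_pow_eq_one.2 ⟨n, hn, Ad_Q_pow n⟩),
    powIndex_zpowers (isOfFinOrder_iff_pow_eq_one.2 ⟨n, hn, Ad_P_pow n⟩), orderOf_Ad_Q,
    orderOf_Ad_P, sq]

/-- `D(n)` is divisible because `ℂˣ` is. -/
theorem powIndex_D {k : ℕ} (hk : k ≠ 0) : powIndex (D n) k = 1 := by
  refine powIndex_eq_one ?_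
  rintro ⟨_, d, rfl⟩
  have (i : Fin n) : ∃ z : ℂˣ, z ^ k = d i := by
    obtain ⟨z, hz⟩ := IsAlgClosed.exists_pow_nat_eq (d i : ℂ) (Nat.pos_of_ne_zero hk)
    have h0 : z ≠ 0 := by
      rintro rfl
      rw [zero_pow hk] at hz
      exact (d i).ne_zero hz.symm
    exact ⟨Units.mk0 z h0, Units.ext hz⟩
  choose e he using this
  refine ⟨⟨_, e, rfl⟩, Subtype.ext ?_⟩
  change ((Ad n).comp (diagGL n)) e ^ k = _
  rw [← map_pow]
  congr 1
  exact funext he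

theorem powIndex_pauliD {L : List ℕ} (hL : ∀ n ∈ L, n ≠ 0) {m : ℕ} (hm : m ≠ 0) {k : ℕ}
    (hk : k ≠ 0) : powIndex (pauliD L m) k = (L.map fun n => n.gcd k).prod ^ 2 := by
  induction L with
  | nil =>
    obtain ⟨e⟩ := (autEquiv_pauliD_nil m).nonempty_mulEquiv
    rw [← powIndex_congr e, powIndex_D hk]
    rfl
  | cons n L ih =>
    have hL' : ∀ k ∈ L, k ≠ 0 := fun k hk => hL k (List.mem_cons_of_mem n hk)
    have : NeZero n := ⟨hL n (by simp)⟩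
    have hprod : L.prod * m ≠ 0 := by
      refine mul_ne_zero ?_ hm
      rw [Ne, List.prod_eq_zero_iff]
      exact fun h => hL' 0 h rfl
    obtain ⟨e⟩ := (autEquiv_pauliD_cons n L m).nonempty_mulEquiv
    obtain ⟨e'⟩ := nonempty_mulEquiv_tensorGroup (NeZero.ne n) hprod (pauli n) (pauliD L m)
    rw [← powIndex_congr e, ← powIndex_congr e', powIndex_prod, ih hL', powIndex_pauli,
      List.map_cons, List.prod_cons, mul_pow]

end Groups

/-! ### Recovering prime powers from gcd products -/

section Arithmetic

theorem gcd_prime_pow_succ {p : ℕ} (hp : p.Prime) (n j : ℕ) :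
    n.gcd (p ^ (j + 1)) = n.gcd (p ^ j) * if p ^ (j + 1) ∣ n then p else 1 := by
  split_ifs with h
  · rw [Nat.gcd_eq_right h, Nat.gcd_eq_right ((pow_dvd_pow p (Nat.le_succ j)).trans h), pow_succ]
  · rw [mul_one]
    refine Nat.dvd_antisymm ?_ (Nat.gcd_dvd_gcd_of_dvd_right _ (pow_dvd_pow p (Nat.le_succ j)))
    refine Nat.dvd_gcd (Nat.gcd_dvd_left _ _) ?_
    obtain ⟨i, hi, heq⟩ := (Nat.dvd_prime_pow hp).1 (Nat.gcd_dvd_right n (p ^ (j + 1)))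
    rw [heq]
    refine pow_dvd_pow p (Nat.lt_succ_iff.1 (lt_of_le_of_ne hi ?_))
    rintro rfl
    exact h (heq ▸ Nat.gcd_dvd_left _ _)

/-- Passing from `p^j` to `p^(j+1)` multiplies a gcd by `p` exactly for entries divisible by
`p^(j+1)`; the quotient of the products counts these entries. -/
theorem prod_gcd_prime_pow_succ {p : ℕ} (hp : p.Prime) (L : List ℕ) (j : ℕ) :
    (L.map fun n => n.gcd (p ^ (j + 1))).prod =
      (L.map fun n => n.gcd (p ^ j)).prod * p ^ L.countP (p ^ (j + 1) ∣ ·) := by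
  induction L with
  | nil => simp
  | cons n L ih =>
    rw [List.map_cons, List.prod_cons, ih, gcd_prime_pow_succ hp, List.map_cons, List.prod_cons,
      List.countP_cons]
    by_cases h : p ^ (j + 1) ∣ n
    · rw [if_pos h, if_pos (decide_eq_true h), pow_add, pow_one]; ring
    · rw [if_neg h, if_neg (by simpa using h), add_zero]; ring

/-- For `j ≥ 1`, a prime power divisible by `p^j` is a power of the same prime: either `p^j` itself
or a multiple of `p^(j+1)`. -/
theorem countP_prime_pow {p : ℕ} (hp : p.Prime) {j : ℕ} (hj : j ≠ 0) {L : List ℕ}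
    (hL : ∀ n ∈ L, IsPrimePow n) :
    L.countP (p ^ j ∣ ·) = L.count (p ^ j) + L.countP (p ^ (j + 1) ∣ ·) := by
  induction L with
  | nil => simp
  | cons n L ih =>
    rw [List.countP_cons, List.countP_cons, List.count_cons,
      ih fun k hk => hL k (List.mem_cons_of_mem n hk)]
    obtain ⟨q, r, hq, hr, rfl⟩ := (isPrimePow_nat_iff n).1 (hL n (by simp))
    have h1 (i : ℕ) (hi : i ≠ 0) : p ^ i ∣ q ^ r ↔ p = q ∧ i ≤ r := by
      constructor
      · intro h
        have hpq : p = q := (Nat.prime_dvd_prime_iff_eq hp hq).1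
          (hp.dvd_of_dvd_pow ((dvd_pow_self p hi).trans h))
        subst hpq
        exact ⟨rfl, (Nat.pow_dvd_pow_iff_le_right hp.one_lt).1 h⟩
      · rintro ⟨rfl, h⟩
        exact pow_dvd_pow p h
    have h2 : q ^ r = p ^ j ↔ p = q ∧ r = j := by
      constructor
      · intro h
        have := (h1 j hj).1 h.symm.dvd
        obtain ⟨rfl, _⟩ := this
        exact ⟨rfl, Nat.pow_right_injective hp.two_le h⟩
      · rintro ⟨rfl, rfl⟩
        rfl
    simp only [h1 j hj, h1 (j + 1) (Nat.succ_ne_zero j), beq_iff_eq, h2, decide_eq_true_eq]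
    by_cases hpq : p = q
    · simp only [hpq, true_and]
      split_ifs <;> omega
    · simp only [hpq, false_and, if_false, add_zero]

theorem perm_of_prod_gcd_eq {L L' : List ℕ} (hL : ∀ n ∈ L, IsPrimePow n)
    (hL' : ∀ n ∈ L', IsPrimePow n)
    (h : ∀ k ≠ 0, (L.map fun n => n.gcd k).prod = (L'.map fun n => n.gcd k).prod) :
    L.Perm L' := by
  have hcount (p : ℕ) (hp : p.Prime) (j : ℕ) (hj : j ≠ 0) :
      L.countP (p ^ j ∣ ·) = L'.countP (p ^ j ∣ ·) := by
    obtain ⟨j, rfl⟩ := Nat.exists_eq_succ_of_ne_zero hj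
    have h1 := h (p ^ (j + 1)) (pow_ne_zero _ hp.ne_zero)
    have h0 := h (p ^ j) (pow_ne_zero _ hp.ne_zero)
    rw [prod_gcd_prime_pow_succ hp, prod_gcd_prime_pow_succ hp, h0] at h1
    refine Nat.pow_right_injective hp.two_le (Nat.eq_of_mul_eq_mul_left ?_ h1)
    refine Nat.pos_of_ne_zero fun h => ?_
    rw [List.prod_eq_zero_iff, List.mem_map] at h
    obtain ⟨n, _, hn⟩ := h
    exact pow_ne_zero _ hp.ne_zero (Nat.gcd_eq_zero_iff.1 hn).2
  rw [List.perm_iff_count]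
  intro x
  by_cases hx : IsPrimePow x
  · obtain ⟨p, j, hp, hj, rfl⟩ := (isPrimePow_nat_iff x).1 hx
    have h1 := countP_prime_pow hp hj.ne' hL
    have h2 := countP_prime_pow hp hj.ne' hL'
    have h3 := hcount p hp j hj.ne'
    have h4 := hcount p hp (j + 1) (Nat.succ_ne_zero j)
    omega
  · rw [List.count_eq_zero_of_not_mem fun h => hx (hL x h),
      List.count_eq_zero_of_not_mem fun h => hx (hL' x h)]

/-- The abstract groups determine the list; only `m` needs the matrix size. -/
theorem perm_of_autEquiv_pauliD {L L' : List ℕ} {m m' : ℕ} (hL : ∀ n ∈ L, IsPrimePow n)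
    (hL' : ∀ n ∈ L', IsPrimePow n) (hm : m ≠ 0) (hm' : m' ≠ 0)
    (h : AutEquiv (pauliD L m) (pauliD L' m')) : L.Perm L' ∧ m = m' := by
  have hL0 : ∀ n ∈ L, n ≠ 0 := fun n hn => (hL n hn).ne_zero
  have hL0' : ∀ n ∈ L', n ≠ 0 := fun n hn => (hL' n hn).ne_zero
  have hperm : L.Perm L' := by
    refine perm_of_prod_gcd_eq hL hL' fun k hk => ?_
    obtain ⟨e⟩ := h.nonempty_mulEquiv
    have := powIndex_congr e k
    rw [powIndex_pauliD hL0 hm hk, powIndex_pauliD hL0' hm' hk] at this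
    exact Nat.pow_left_injective two_ne_zero this
  refine ⟨hperm, ?_⟩
  have hsize := h.size_eq
  rw [hperm.prod_eq] at hsize
  refine Nat.eq_of_mul_eq_mul_left (Nat.pos_of_ne_zero ?_) hsize
  rw [Ne, List.prod_eq_zero_iff]
  exact fun h => hL0' 0 h rfl

end Arithmetic

/-! ### Diagonalizable lifts and their roots -/

section Lifts

variable {n : ℕ}

/-- If `Ad_A` is diagonalizable, so is `A`: for an eigenvector `v` of `A`, the surjection
`X ↦ X v` intertwines a multiple of `Ad_A` with `A`. -/
theorem isSemisimple_of_isDiag_Ad {A : GL (Fin n) ℂ} (hA : IsDiag (Ad n A)) :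
    Module.End.IsSemisimple (Matrix.toLin' (A : Mat n)) := by
  obtain rfl | hn := Nat.eq_zero_or_pos n
  · refine isSemisimple_of_pow_eq_one one_ne_zero ?_
    ext x i
    exact i.elim0
  have : Nonempty (Fin n) := ⟨⟨0, hn⟩⟩
  obtain ⟨μ, hμ⟩ := Module.End.exists_eigenvalue (Matrix.toLin' (A : Mat n))
  obtain ⟨v, hv, hv0⟩ := hμ.exists_hasEigenvector
  rw [Module.End.mem_eigenspace_iff, Matrix.toLin'_apply] at hv
  obtain ⟨i, hi⟩ := Function.ne_iff.1 hv0
  have hinv : ((A⁻¹ : GL (Fin n) ℂ) : Mat n).mulVec v = μ⁻¹ • v := by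
    have h1 := congrArg (((A⁻¹ : GL (Fin n) ℂ) : Mat n).mulVec) hv
    rw [Matrix.mulVec_mulVec, Units.inv_mul, Matrix.one_mulVec, Matrix.mulVec_smul] at h1
    have hμ0 : μ ≠ 0 := by
      rintro rfl
      rw [zero_smul] at h1
      exact hv0 h1
    conv_rhs => rw [h1]
    rw [smul_smul, inv_mul_cancel₀ hμ0, one_smul]
  have hμ0 : μ ≠ 0 := by
    rintro rfl
    rw [inv_zero, zero_smul] at hinv
    have h1 := congrArg ((A : Mat n).mulVec) hinv
    rw [Matrix.mulVec_mulVec, Units.mul_inv, Matrix.one_mulVec, Matrix.mulVec_zero] at h1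
    exact hv0 h1
  let T : Mat n →ₗ[ℂ] (Fin n → ℂ) :=
    { toFun := fun X => X.mulVec v
      map_add' := fun X Y => Matrix.add_mulVec X Y v
      map_smul' := fun c X => Matrix.smul_mulVec c X v }
  refine isSemisimple_of_surjective
    (f := μ • (Ad n A).toLinearMap) (Module.End.IsSemisimple_smul μ (isDiag_iff.1 hA)) T ?_ ?_
  · intro w
    -- A rank-one matrix supported in column `i`, where `v i ≠ 0`, carries `v` to `w`.
    refine ⟨Matrix.vecMulVec w (Pi.single i (v i)⁻¹), ?_⟩
    change (Matrix.vecMulVec w (Pi.single i (v i)⁻¹)).mulVec v = w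
    rw [Matrix.vecMulVec_mulVec, single_dotProduct, inv_mul_cancel₀ hi]
    simp
  · intro X
    change (μ • Ad n A X).mulVec v = Matrix.toLin' (A : Mat n) (X.mulVec v)
    rw [Ad_apply, Matrix.smul_mulVec, ← Matrix.mulVec_mulVec, hinv, Matrix.mulVec_smul, smul_smul,
      mul_inv_cancel₀ hμ0, one_smul, Matrix.toLin'_apply, Matrix.mulVec_mulVec]

/-- An invertible diagonalizable matrix has a `k`-th root which is a polynomial in it. -/
theorem exists_aeval_pow_eq {Z : Mat n} (hZ : Module.End.IsSemisimple (Matrix.toLin' Z)) {k : ℕ}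
    (hk : k ≠ 0) : ∃ p : Polynomial ℂ, (Polynomial.aeval Z p) ^ k = Z := by
  classical
  have hfin := Module.End.finite_hasEigenvalue (Matrix.toLin' Z)
  choose r hr using fun z : ℂ => IsAlgClosed.exists_pow_nat_eq z (Nat.pos_of_ne_zero hk)
  -- `p` takes a chosen `k`-th root as value at each eigenvalue.
  let p := Lagrange.interpolate hfin.toFinset id r
  refine ⟨p, ?_⟩
  have hlin : (Polynomial.aeval (Matrix.toLin' Z) p) ^ k = Matrix.toLin' Z := by
    have htop := hZ.iSup_eigenspace_eq_top
    rw [← map_pow]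
    have : LinearMap.eqLocus (Polynomial.aeval (Matrix.toLin' Z) (p ^ k)) (Matrix.toLin' Z) = ⊤ := by
      rw [eq_top_iff, ← htop]
      refine iSup_le fun μ v hv => ?_
      by_cases hv0 : v = 0
      · rw [hv0]
        exact zero_mem _
      have hev : Module.End.HasEigenvector (Matrix.toLin' Z) μ v := ⟨hv, hv0⟩
      have hmem : μ ∈ hfin.toFinset := by
        simpa using Module.End.hasEigenvalue_of_hasEigenvector hev
      rw [LinearMap.mem_eqLocus, Module.End.aeval_apply_of_hasEigenvector hev, Polynomial.eval_pow]
      have : p.eval (id μ) = r μ :=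
        Lagrange.eval_interpolate_at_node r (Function.injective_id.injOn) hmem
      rw [id] at this
      rw [this, hr, Module.End.mem_eigenspace_iff.1 hv]
    exact LinearMap.ext fun v => this.ge (Submodule.mem_top : v ∈ ⊤)
  apply (Matrix.toLinAlgEquiv' (R := ℂ) (n := Fin n)).injective
  rw [map_pow, ← Polynomial.aeval_algHom_apply]
  exact hlin

/-- For diagonalizable `Ad_A`, a `k`-th root of `A ^ k` fixed by all automorphisms which
fix `A ^ k`. -/
theorem exists_pow_eq_pow {A : GL (Fin n) ℂ} (hA : IsDiag (Ad n A)) {k : ℕ} (hk : k ≠ 0) :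
    ∃ W : GL (Fin n) ℂ, W ^ k = A ^ k ∧
      ∀ x : AutMat n, x ((A : Mat n) ^ k) = (A : Mat n) ^ k → x W = (W : Mat n) := by
  have hss : Module.End.IsSemisimple (Matrix.toLin' ((A : Mat n) ^ k)) := by
    rw [Matrix.toLin'_pow]
    exact (isSemisimple_of_isDiag_Ad hA).pow k
  obtain ⟨p, hp⟩ := exists_aeval_pow_eq hss hk
  have hu : IsUnit (Polynomial.aeval ((A : Mat n) ^ k) p) := by
    rw [← isUnit_pow_iff hk, hp]
    exact A.isUnit.pow k
  obtain ⟨W, hW⟩ := hu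
  refine ⟨W, Units.ext ?_, fun x hx => ?_⟩
  · rw [Units.val_pow_eq_pow_val, Units.val_pow_eq_pow_val, hW, hp]
  · rw [hW]
    have := Polynomial.aeval_algHom_apply (x : Mat n →ₐ[ℂ] Mat n) ((A : Mat n) ^ k) p
    change _ = x _ at this
    rw [← this]
    change Polynomial.aeval (x ((A : Mat n) ^ k)) p = _
    rw [hx]

end Lifts

/-! ### Bases adapted to commuting lifts and to Pauli pairs -/

section Bases

variable {N M : ℕ}

/-- The isomorphism of matrix algebras given by a basis of `ℂ^N`. -/
def basisAlgEquiv (β : Module.Basis (Fin M) ℂ (Fin N → ℂ)) : Mat N ≃ₐ[ℂ] Mat M :=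
  (Matrix.toLinAlgEquiv' (R := ℂ) (n := Fin N)).trans (LinearMap.toMatrixAlgEquiv β)

theorem basisAlgEquiv_apply (β : Module.Basis (Fin M) ℂ (Fin N → ℂ)) (A : Mat N) (i j : Fin M) :
    basisAlgEquiv β A i j = β.repr (A.mulVec (β j)) i := by
  change LinearMap.toMatrixAlgEquiv β (Matrix.toLinAlgEquiv' A) i j = _
  rw [LinearMap.toMatrixAlgEquiv_apply, Matrix.toLinAlgEquiv'_apply]

theorem autCongr_Ad (φ : Mat N ≃ₐ[ℂ] Mat M) (A : GL (Fin N) ℂ) :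
    AlgEquiv.autCongr φ (Ad N A) = Ad M (Units.map (φ : Mat N →* Mat M) A) := by
  ext1 X
  change φ (Ad N A (φ.symm X)) = _
  rw [Ad_apply, Ad_apply, map_mul, map_mul, AlgEquiv.apply_symm_apply]
  rfl

/-- An abelian group of diagonalizable automorphisms whose lifts commute is conjugate to
a subgroup of the group of diagonal automorphisms. -/
theorem exists_le_autEquiv_D {G : Subgroup (AutMat N)} (hG : IsAbelianDiagInner G)
    (h : ∀ A : GL (Fin N) ℂ, Ad N A ∈ G → ∀ x ∈ G, x A = (A : Mat N)) :
    ∃ G' : Subgroup (AutMat N), G ≤ G' ∧ AutEquiv (D N) G' := by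
  classical
  let ι := {A : GL (Fin N) ℂ // Ad N A ∈ G}
  let f : ι → Module.End ℂ (Fin N → ℂ) := fun A => Matrix.toLin' (A.1 : Mat N)
  have hss (i : ι) : (f i).IsSemisimple := isSemisimple_of_isDiag_Ad (hG.diag _ i.2)
  have hgen (i : ι) (μ : ℂ) : (f i).maxGenEigenspace μ = (f i).eigenspace μ :=
    (hss i).isFinitelySemisimple.maxGenEigenspace_eq_eigenspace μ
  have hcomm (i j : ι) : Commute (f i) (f j) := by
    have := Ad_fixes_iff.1 (h j.1 j.2 (Ad N i.1) i.2)
    change f i * f j = f j * f i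
    rw [Module.End.mul_eq_comp, Module.End.mul_eq_comp, ← Matrix.toLin'_mul, this,
      Matrix.toLin'_mul]
  have htop : ⨆ χ : ι → ℂ, ⨅ i, (f i).eigenspace (χ i) = ⊤ := by
    have := Module.End.iSup_iInf_maxGenEigenspace_eq_top_of_iSup_maxGenEigenspace_eq_top_of_commute
      f (fun i j _ => hcomm i j) (fun i => by simp only [hgen]; exact (hss i).iSup_eigenspace_eq_top)
    simpa only [hgen] using this
  let s : Set (Fin N → ℂ) := {v | ∃ χ : ι → ℂ, v ∈ ⨅ i, (f i).eigenspace (χ i)}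
  have hs : Submodule.span ℂ s = ⊤ := by
    rw [eq_top_iff, ← htop]
    exact iSup_le fun χ v hv => Submodule.subset_span ⟨χ, hv⟩
  -- A basis is picked out of the spanning set of common eigenvectors.
  obtain ⟨t, hts, htspan, hli⟩ := exists_linearIndependent ℂ s
  let β₀ : Module.Basis t ℂ (Fin N → ℂ) := Module.Basis.mk hli (by
    rw [Subtype.range_coe, htspan, hs])
  have : Finite t := Module.Finite.finite_basis β₀
  have : Fintype t := Fintype.ofFinite t
  have hcard : Fintype.card t = N := by
    rw [← Module.finrank_eq_card_basis β₀, Module.finrank_fin_fun]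
  let β := β₀.reindex (Fintype.equivFinOfCardEq hcard)
  have hβ (j : Fin N) : ∃ χ : ι → ℂ, ∀ i, (i.1 : Mat N).mulVec (β j) = χ i • β j := by
    have hj : β j ∈ s := by
      rw [Module.Basis.reindex_apply, Module.Basis.mk_apply]
      exact hts (Subtype.prop _)
    obtain ⟨χ, hχ⟩ := hj
    refine ⟨χ, fun i => ?_⟩
    have := (Submodule.mem_iInf _).1 hχ i
    rwa [Module.End.mem_eigenspace_iff, Matrix.toLin'_apply] at this
  choose χ hχ using hβ
  refine ⟨_, ?_, ⟨(basisAlgEquiv β).symm, rfl⟩⟩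
  intro g hg
  obtain ⟨A, rfl⟩ := Ad_surjective g
  let i : ι := ⟨A, hg⟩
  have hdiag : basisAlgEquiv β A = Matrix.diagonal fun j => χ j i := by
    ext k j
    rw [basisAlgEquiv_apply, hχ j i, map_smul, Finsupp.smul_apply, Module.Basis.repr_self,
      Finsupp.single_apply, Matrix.diagonal_apply]
    by_cases hkj : k = j
    · simp [hkj]
    · simp [hkj, Ne.symm hkj]
  have hne (j : Fin N) : χ j i ≠ 0 := by
    intro h0
    have h1 := hχ j i
    rw [h0, zero_smul] at h1
    have h2 := congrArg (((A⁻¹ : GL (Fin N) ℂ) : Mat N).mulVec) h1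
    rw [Matrix.mulVec_mulVec, Units.inv_mul, Matrix.one_mulVec, Matrix.mulVec_zero] at h2
    exact β.ne_zero j h2
  have hmem : AlgEquiv.autCongr (basisAlgEquiv β) (Ad N A) ∈ D N := by
    rw [autCongr_Ad]
    refine ⟨fun j => Units.mk0 _ (hne j), ?_⟩
    rw [MonoidHom.comp_apply]
    congr 1
    ext1
    rw [diagGL_val]
    exact hdiag.symm
  refine ⟨_, hmem, ?_⟩
  change AlgEquiv.autCongr (basisAlgEquiv β).symm _ = _
  rw [← AlgEquiv.autCongr_symm, MulEquiv.symm_apply_apply]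

/-- Matrices with the relations of `Q_n` and `P_n` are conjugate to `Q_n ⊗ 1` and `P_n ⊗ 1`. -/
theorem exists_algEquiv_kron {n : ℕ} (hn : n ≠ 0) {A B : GL (Fin N) ℂ} (hA : A ^ n = 1)
    (hB : B ^ n = 1) (hBA : (B : Mat N) * A = (omega n : ℂ) • ((A : Mat N) * B)) :
    ∃ (b : ℕ) (φ : Mat N ≃ₐ[ℂ] Mat (n * b)), φ A = kron n b ((Q n : Mat n) ⊗ₜ 1) ∧
      φ B = kron n b ((P n : Mat n) ⊗ₜ 1) := by
  have hprim := omega_isPrimitiveRoot hn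
  let f : Module.End ℂ (Fin N → ℂ) := Matrix.toLin' (A : Mat N)
  have hfn : f ^ n = 1 := by
    rw [← Matrix.toLin'_pow, ← Units.val_pow_eq_pow_val, hA, Units.val_one, Matrix.toLin'_one]
    rfl
  let E : Fin n → Submodule ℂ (Fin N → ℂ) := fun k => f.eigenspace ((omega n : ℂ) ^ (k : ℕ))
  have hmemE (k : Fin n) (v : Fin N → ℂ) :
      v ∈ E k ↔ (A : Mat N).mulVec v = (omega n : ℂ) ^ (k : ℕ) • v := by
    rw [Module.End.mem_eigenspace_iff, Matrix.toLin'_apply]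
  have hint : DirectSum.IsInternal E := by
    refine DirectSum.isInternal_submodule_of_iSupIndep_of_iSup_eq_top
      (f.eigenspaces_iSupIndep.comp (f := fun k : Fin n => (omega n : ℂ) ^ (k : ℕ))
        fun i j hij => Fin.ext (hprim.pow_inj i.2 j.2 hij)) ?_
    rw [eq_top_iff, ← (isSemisimple_of_pow_eq_one hn hfn).iSup_eigenspace_eq_top]
    refine iSup_le fun μ v hv => ?_
    by_cases hv0 : v = 0
    · rw [hv0]; exact zero_mem _
    have hμ : μ ^ n = 1 := by
      have h1 := Module.End.HasEigenvector.pow_apply ⟨hv, hv0⟩ n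
      rw [hfn, Module.End.one_apply] at h1
      have h2 : (μ ^ n - 1) • v = 0 := by rw [sub_smul, ← h1, one_smul, sub_self]
      exact sub_eq_zero.1 ((smul_eq_zero.1 h2).resolve_right hv0)
    have : NeZero n := ⟨hn⟩
    obtain ⟨i, hi, rfl⟩ := hprim.eq_pow_of_pow_eq_one hμ
    exact le_iSup E ⟨i, hi⟩ hv
  -- `C = B⁻¹` satisfies `AC = ωCA`, so it raises the eigenvalue exponent of `A` by one and `C^k`
  -- maps `E_0` onto `E_k`.
  let C : Mat N := ((B⁻¹ : GL (Fin N) ℂ) : Mat N)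
  have hBC : (B : Mat N) * C = 1 := B.mul_inv
  have hCB : C * (B : Mat N) = 1 := B.inv_mul
  have hCn : C ^ n = 1 := by
    rw [← Units.val_pow_eq_pow_val, inv_pow, hB, inv_one, Units.val_one]
  have hAC : (A : Mat N) * C = (omega n : ℂ) • (C * A) := by
    calc (A : Mat N) * C = C * (B * A) * C := by rw [← mul_assoc, hCB, one_mul]
      _ = _ := by
        rw [hBA, mul_smul_comm, smul_mul_assoc, mul_assoc C, mul_assoc (A : Mat N), hBC, mul_one]
  have hACk (k : ℕ) : (A : Mat N) * C ^ k = (omega n : ℂ) ^ k • (C ^ k * A) := by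
    induction k with
    | zero => simp
    | succ k ih =>
      rw [pow_succ C, ← mul_assoc, ih, smul_mul_assoc, mul_assoc, hAC, mul_smul_comm, smul_smul,
        mul_assoc, pow_succ]
  have hCk (k : ℕ) : B.val ^ k * C ^ k = 1 := by
    rw [← Units.val_pow_eq_pow_val, ← Units.val_pow_eq_pow_val, inv_pow, Units.mul_inv]
  have hCk' (k : ℕ) : C ^ k * B.val ^ k = 1 := by
    rw [← Units.val_pow_eq_pow_val, ← Units.val_pow_eq_pow_val, inv_pow, Units.inv_mul]
  let z : Fin n := ⟨0, Nat.pos_of_ne_zero hn⟩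
  let e (k : ℕ) : (Fin N → ℂ) ≃ₗ[ℂ] (Fin N → ℂ) := Matrix.toLin'OfInv (hCk k) (hCk' k)
  have he (k : ℕ) (v : Fin N → ℂ) : (C ^ k).mulVec v = e k v := rfl
  have hE (k : Fin n) : (E z).map (e k : (Fin N → ℂ) →ₗ[ℂ] (Fin N → ℂ)) = E k := by
    have key (v : Fin N → ℂ) : e k v ∈ E k ↔ v ∈ E z := by
      rw [hmemE, hmemE, ← he, Matrix.mulVec_mulVec, hACk, Matrix.smul_mulVec,
        ← Matrix.mulVec_mulVec, pow_zero, one_smul]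
      rw [(smul_right_injective _ (pow_ne_zero (k : ℕ) omega_ne_zero)).eq_iff, he, he,
        (e k).injective.eq_iff]
    ext v
    constructor
    · rintro ⟨w, hw, rfl⟩
      exact (key w).2 hw
    · intro hv
      refine ⟨(e k).symm v, (key _).1 ?_, (e k).apply_symm_apply v⟩
      rwa [LinearEquiv.apply_symm_apply]
  let b := Module.finrank ℂ (E z)
  let β₀ : Module.Basis (Fin b) ℂ (E z) := Module.finBasis ℂ (E z)
  -- Each `E_k` gets the basis of `E_0` moved by `C^k`, so that `B` shifts basis vectors from
  -- `E_(k+1)` to `E_k`, as `P_n ⊗ 1` does.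
  let γ (k : Fin n) : Module.Basis (Fin b) ℂ (E k) :=
    β₀.map (((e k).submoduleMap (E z)).trans (LinearEquiv.ofEq _ _ (hE k)))
  let β : Module.Basis (Fin (n * b)) ℂ (Fin N → ℂ) :=
    (hint.collectedBasis γ).reindex ((Equiv.sigmaEquivProd _ _).trans finProdFinEquiv)
  have hβ (k : Fin n) (s : Fin b) :
      β (finProdFinEquiv (k, s)) = (C ^ (k : ℕ)).mulVec (β₀ s) := by
    rw [Module.Basis.reindex_apply, Equiv.symm_trans_apply, Equiv.symm_apply_apply,
      DirectSum.IsInternal.collectedBasis_coe]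
    rfl
  have hAβ (k : Fin n) (s : Fin b) : (A : Mat N).mulVec (β (finProdFinEquiv (k, s))) =
      (omega n : ℂ) ^ (k : ℕ) • β (finProdFinEquiv (k, s)) := by
    have h0 := (hmemE z _).1 (β₀ s).2
    rw [pow_zero, one_smul] at h0
    rw [hβ, Matrix.mulVec_mulVec, hACk, Matrix.smul_mulVec, ← Matrix.mulVec_mulVec, h0]
  have hBβ (k : Fin n) (s : Fin b) : (B : Mat N).mulVec (β (finProdFinEquiv (finRotate n k, s))) =
      β (finProdFinEquiv (k, s)) := by
    have hval : ((finRotate n k : Fin n) : ℕ) = (k + 1) % n := by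
      obtain ⟨n, rfl⟩ := Nat.exists_eq_succ_of_ne_zero hn
      simp [Fin.val_add]
    -- `C^n = 1` takes care of the wrap-around from `n - 1` to `0`.
    rw [hβ, hβ, hval, ← pow_eq_pow_mod _ hCn, Matrix.mulVec_mulVec, pow_succ', ← mul_assoc, hBC,
      one_mul]
  refine ⟨b, basisAlgEquiv β, ?_, ?_⟩
  · ext x y
    obtain ⟨⟨i, s⟩, rfl⟩ := finProdFinEquiv.surjective x
    obtain ⟨⟨j, t⟩, rfl⟩ := finProdFinEquiv.surjective y
    rw [basisAlgEquiv_apply, hAβ, map_smul, Finsupp.smul_apply, Module.Basis.repr_self,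
      kron_tmul_apply, Q, diagGL_val, Matrix.diagonal_apply, Matrix.one_apply]
    simp only [Finsupp.single_apply, EmbeddingLike.apply_eq_iff_eq, Prod.mk.injEq, eq_comm (a := j),
      eq_comm (a := t)]
    by_cases hij : i = j <;> by_cases hst : s = t <;> simp [hij, hst]
  · ext x y
    obtain ⟨⟨i, s⟩, rfl⟩ := finProdFinEquiv.surjective x
    obtain ⟨⟨j, t⟩, rfl⟩ := finProdFinEquiv.surjective y
    obtain ⟨j, rfl⟩ := (finRotate n).surjective j
    rw [basisAlgEquiv_apply, hBβ, Module.Basis.repr_self, kron_tmul_apply,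
      P_apply_finRotate, Matrix.one_apply]
    simp only [Finsupp.single_apply, EmbeddingLike.apply_eq_iff_eq, Prod.mk.injEq, eq_comm (a := j),
      eq_comm (a := t)]
    by_cases hij : i = j <;> by_cases hst : s = t <;> simp [hij, hst]

end Bases

/-! ### Embedding abelian groups into standard groups -/

section Existence

variable {N : ℕ}

theorem pow_eq_one_of_apply_GL_eq_smul {g : AutMat N} {B : GL (Fin N) ℂ} {c : ℂ}
    (h : g B = c • (B : Mat N)) : c ^ N = 1 := by
  have h1 := det_aut g B
  rw [h, Matrix.det_smul, Fintype.card_fin] at h1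
  have h0 : (B : Mat N).det ≠ 0 := ((Matrix.isUnit_iff_isUnit_det _).1 B.isUnit).ne_zero
  exact mul_right_cancel₀ h0 (by rw [h1, one_mul])

theorem apply_pow_eq_smul {g : AutMat N} {B : GL (Fin N) ℂ} {c : ℂ}
    (h : g B = c • (B : Mat N)) (k : ℕ) :
    g ((B ^ k : GL (Fin N) ℂ) : Mat N) = c ^ k • ((B ^ k : GL (Fin N) ℂ) : Mat N) := by
  rw [Units.val_pow_eq_pow_val, map_pow, h, smul_pow]

/-- In an abelian group with noncommuting lifts there are two elements whose lifts commute up to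
a primitive root of unity of prime power order `n`, and commute with all other lifts up to `n`-th
roots of unity. -/
theorem exists_pair_of_lifts_not_commute (hN : N ≠ 0) {G : Subgroup (AutMat N)}
    (hG : IsAbelianDiagInner G)
    (h : ¬ ∀ A : GL (Fin N) ℂ, Ad N A ∈ G → ∀ x ∈ G, x A = (A : Mat N)) :
    ∃ n, IsPrimePow n ∧ ∃ A B : GL (Fin N) ℂ, Ad N A ∈ G ∧ Ad N B ∈ G ∧
      Ad N B A = (omega n : ℂ) • (A : Mat N) ∧
      (∀ x ∈ G, ∃ c : ℂ, c ^ n = 1 ∧ x A = c • (A : Mat N)) ∧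
      (∀ x ∈ G, ∃ c : ℂ, c ^ n = 1 ∧ x B = c • (B : Mat N)) := by
  classical
  -- The values of the commutation pairing of `G`.
  let val (c : ℂ) : Prop := ∃ A B : GL (Fin N) ℂ, Ad N A ∈ G ∧ Ad N B ∈ G ∧
    Ad N B A = c • (A : Mat N)
  have hex (A : GL (Fin N) ℂ) (hA : Ad N A ∈ G) (x : AutMat N) (hx : x ∈ G) :
      ∃ c : ℂ, val c ∧ x A = c • (A : Mat N) := by
    obtain ⟨c, hc⟩ := exists_apply_eq_smul (hG.comm x hx _ hA)
    obtain ⟨B, rfl⟩ := Ad_surjective x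
    exact ⟨c, ⟨A, B, hA, hx, hc⟩, hc⟩
  have hvalN (c : ℂ) (hc : val c) : c ^ N = 1 := by
    obtain ⟨A, B, _, _, h⟩ := hc
    exact pow_eq_one_of_apply_GL_eq_smul h
  push Not at h
  obtain ⟨A₁, hA₁, x₁, hx₁, hne⟩ := h
  obtain ⟨c₁, hc₁, hxc₁⟩ := hex A₁ hA₁ x₁ hx₁
  have hc₁1 : c₁ ≠ 1 := by
    rintro rfl
    exact hne (by rw [hxc₁, one_smul])
  obtain ⟨p, hp, hpd⟩ := Nat.exists_prime_and_dvd (mt orderOf_eq_one_iff.1 hc₁1)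
  let R (s : ℕ) : Prop := ∃ c, val c ∧ p ^ s ∣ orderOf c
  have hbound (s : ℕ) (hs : R s) : s ≤ N := by
    obtain ⟨c, hc, hd⟩ := hs
    have h1 := Nat.le_of_dvd (Nat.pos_of_ne_zero hN)
      (hd.trans (orderOf_dvd_of_pow_eq_one (hvalN c hc)))
    exact (Nat.lt_pow_self hp.one_lt).le.trans h1
  have hR1 : R 1 := ⟨c₁, hc₁, by rwa [pow_one]⟩
  let r := Nat.findGreatest R N
  have hr1 : 1 ≤ r := Nat.le_findGreatest (hbound 1 hR1) hR1
  have hRr : R r := Nat.findGreatest_spec (hbound 1 hR1) hR1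
  have hmax (s : ℕ) (hs : R s) : s ≤ r := Nat.le_findGreatest (hbound s hs) hs
  -- `K` is the part of `N` prime to `p`. By maximality of `r`, the `K`-th power of every value is a
  -- `p^r`-th root of unity.
  let K := N / p ^ N.factorization p
  have hK : Nat.Coprime p K := Nat.coprime_ordCompl hp hN
  have hNK : p ^ N.factorization p * K = N := Nat.ordProj_mul_ordCompl_eq_self N p
  have hpow (c : ℂ) (hc : val c) : (c ^ K) ^ p ^ r = 1 := by
    have h1 : orderOf (c ^ K) ∣ p ^ N.factorization p := by
      apply orderOf_dvd_of_pow_eq_one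
      rw [← pow_mul, mul_comm, hNK, hvalN c hc]
    obtain ⟨s, -, hs⟩ := (Nat.dvd_prime_pow hp).1 h1
    have hsr : s ≤ r := hmax s ⟨c, hc, hs ▸ orderOf_pow_dvd K⟩
    rw [← orderOf_dvd_iff_pow_eq_one, hs]
    exact pow_dvd_pow p hsr
  obtain ⟨c, ⟨A₀, B₀, hA₀, hB₀, hcAB⟩, hdvd⟩ := hRr
  have hcval : val c := ⟨A₀, B₀, hA₀, hB₀, hcAB⟩
  -- The exponent is `K * K` because both lifts are raised to the power `K`; being prime to `p`, it
  -- leaves the `p`-part of the order intact.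
  have hprim : IsPrimitiveRoot (c ^ (K * K)) (p ^ r) := by
    rw [IsPrimitiveRoot.iff_orderOf]
    obtain ⟨q, hq⟩ := Nat.exists_eq_succ_of_ne_zero (Nat.one_le_iff_ne_zero.1 hr1)
    have : Fact p.Prime := ⟨hp⟩
    rw [hq] at hpow hdvd ⊢
    refine orderOf_eq_prime_pow (fun h1 => ?_) ?_
    · rw [← pow_mul] at h1
      have h2 := hdvd.trans (orderOf_dvd_of_pow_eq_one h1)
      have h3 : p ^ (q + 1) ∣ p ^ q := (Nat.Coprime.pow_left _ (hK.mul_right hK)).dvd_of_dvd_mul_left h2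
      exact absurd ((Nat.pow_dvd_pow_iff_le_right hp.one_lt).1 h3) (by omega)
    · rw [pow_mul, ← pow_mul, mul_comm K, pow_mul, hpow c hcval, one_pow]
  have hn0 : p ^ r ≠ 0 := pow_ne_zero _ hp.ne_zero
  have : NeZero (p ^ r) := ⟨hn0⟩
  -- The further exponent `j` on `B₀` turns this primitive root into `ω_n`.
  obtain ⟨j, -, hj⟩ := hprim.eq_pow_of_pow_eq_one (omega_isPrimitiveRoot hn0).pow_eq_one
  refine ⟨p ^ r, hp.isPrimePow.pow (Nat.one_le_iff_ne_zero.1 hr1), A₀ ^ K, B₀ ^ (K * j), ?_, ?_, ?_,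
    fun x hx => ?_, fun x hx => ?_⟩
  · rw [map_pow]; exact pow_mem hA₀ K
  · rw [map_pow]; exact pow_mem hB₀ _
  · rw [map_pow, pow_apply_eq_smul (apply_pow_eq_smul hcAB K), ← hj, ← pow_mul, ← pow_mul, mul_assoc]
  · obtain ⟨d, hd, hxd⟩ := hex A₀ hA₀ x hx
    exact ⟨d ^ K, hpow d hd, apply_pow_eq_smul hxd K⟩
  · obtain ⟨d, hd, hxd⟩ := hex B₀ hB₀ x hx
    refine ⟨d ^ (K * j), ?_, apply_pow_eq_smul hxd _⟩
    rw [pow_mul, ← pow_mul, mul_comm j, pow_mul, hpow d hd, one_pow]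

/-- Division by a root of `A ^ n` turns a lift `A` into one of order dividing `n` with the same
eigenvalues under the elements of `G`. -/
theorem exists_normalized_lift {G : Subgroup (AutMat N)} {n : ℕ} (hn : n ≠ 0)
    {A : GL (Fin N) ℂ} (hAd : IsDiag (Ad N A))
    (hA : ∀ x ∈ G, ∃ c : ℂ, c ^ n = 1 ∧ x A = c • (A : Mat N)) :
    ∃ W : GL (Fin N) ℂ, (W⁻¹ * A) ^ n = 1 ∧
      (∀ x : AutMat N, x A = (A : Mat N) → x W = (W : Mat N)) ∧
      ∀ x ∈ G, x W = (W : Mat N) := by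
  obtain ⟨W, hW, hfix⟩ := exists_pow_eq_pow hAd hn
  have hfixA (x : AutMat N) (hx : x A = (A : Mat N)) : x W = (W : Mat N) :=
    hfix x (by rw [map_pow, hx])
  have hAA : Ad N A A = (A : Mat N) := Ad_fixes_iff.2 rfl
  have hcomm : Commute A W := Units.ext (Ad_fixes_iff.1 (hfixA _ hAA))
  refine ⟨W, ?_, hfixA, fun x hx => ?_⟩
  · rw [hcomm.symm.inv_left.mul_pow, inv_pow, hW, inv_mul_cancel]
  · obtain ⟨c, hc, hxc⟩ := hA x hx
    exact hfix x (by rw [map_pow, hxc, smul_pow, hc, one_smul])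

theorem apply_inv_mul_eq_smul {x : AutMat N} {W A : GL (Fin N) ℂ} {c : ℂ}
    (hW : x W = (W : Mat N)) (hA : x A = c • (A : Mat N)) :
    x ((W⁻¹ * A : GL (Fin N) ℂ) : Mat N) = c • ((W⁻¹ * A : GL (Fin N) ℂ) : Mat N) := by
  have h : x ((W⁻¹ : GL (Fin N) ℂ) : Mat N) = ((W⁻¹ : GL (Fin N) ℂ) : Mat N) := by
    have h1 : x (W : Mat N) * x ((W⁻¹ : GL (Fin N) ℂ) : Mat N) = 1 := by
      rw [← map_mul, Units.mul_inv, map_one]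
    rw [hW] at h1
    exact (Units.inv_eq_of_mul_eq_one_right h1).symm
  rw [Units.val_mul, map_mul, h, hA, mul_smul_comm]

theorem IsDiag.of_tensorAut_one {a b : ℕ} (ha : a ≠ 0) {k : AutMat b}
    (h : IsDiag (PauliMAD.tensorAut a b (1, k))) : IsDiag k := by
  rw [isDiag_iff] at h ⊢
  let T : Mat b →ₗ[ℂ] Mat (a * b) :=
    (kron a b).toLinearMap ∘ₗ TensorProduct.mk ℂ (Mat a) (Mat b) 1
  refine isSemisimple_of_injective h T (kron_one_injective ha) fun Y => ?_
  exact (tensorAut_kron a b 1 k 1 Y).symm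

/-- The second factor of a group of automorphisms all of which are tensor products of elements of
the Pauli group with automorphisms of the second factor. -/
theorem exists_le_tensorGroup_pauli {a b : ℕ} (ha : a ≠ 0) (hb : b ≠ 0)
    {G : Subgroup (AutMat (a * b))} (hG : IsAbelianDiagInner G)
    (h : ∀ g ∈ G, ∃ t ∈ pauli a, ∃ k : AutMat b, g = tensorAut a b (t, k)) :
    ∃ H : Subgroup (AutMat b), IsAbelianDiagInner H ∧ G ≤ tensorGroup (pauli a) H := by
  -- The second components of all `(t, k)` with `t` in the Pauli group and `t ⊗ k` in `G`.
  let H : Subgroup (AutMat b) :=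
    ((pauli a).prod ⊤ ⊓ G.comap (tensorAut a b)).map (MonoidHom.snd _ _)
  have hpauli := pauli_isAbelianDiagInner ha
  refine ⟨H, ⟨fun g _ => mem_Inn g, ?_, ?_⟩, fun g hg => ?_⟩
  · rintro _ ⟨⟨t, k⟩, ⟨_, hk⟩, rfl⟩ _ ⟨⟨t', k'⟩, ⟨_, hk'⟩, rfl⟩
    have := hG.comm _ hk _ hk'
    rw [← map_mul, ← map_mul] at this
    exact congrArg Prod.snd (tensorAut_injective ha hb this)
  · rintro _ ⟨⟨t, k⟩, ⟨⟨ht, _⟩, hk⟩, rfl⟩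
    apply IsDiag.of_tensorAut_one ha
    -- `1 ⊗ k` is the product of the commuting diagonalizable automorphisms `t⁻¹ ⊗ 1` and `t ⊗ k`.
    have ht1 : IsDiag (tensorAut a b (t⁻¹, 1)) :=
      (hpauli.diag _ (inv_mem ht)).tensorAut (isDiag_of_pow_eq_one one_ne_zero (one_pow 1))
    have := IsDiag.mul ht1 (hG.diag _ hk) (by
      rw [← map_mul, ← map_mul]
      simp)
    rw [← map_mul] at this
    simpa using this
  · obtain ⟨t, ht, k, rfl⟩ := h g hg
    exact ⟨(t, k), ⟨ht, ⟨(t, k), ⟨⟨ht, trivial⟩, hg⟩, rfl⟩⟩, rfl⟩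

theorem tensorGroup_mono {a b : ℕ} (G : Subgroup (AutMat a)) {H H' : Subgroup (AutMat b)}
    (h : H ≤ H') : tensorGroup G H ≤ tensorGroup G H' :=
  Subgroup.map_mono (Subgroup.prod_mono le_rfl h)

/-- Every abelian group of diagonalizable automorphisms is contained in a conjugate of a standard
group. -/
theorem exists_le_autEquiv_pauliD (hN : N ≠ 0) {G : Subgroup (AutMat N)}
    (hG : IsAbelianDiagInner G) :
    ∃ (L : List ℕ) (m : ℕ), (∀ n ∈ L, IsPrimePow n) ∧
      ∃ G' : Subgroup (AutMat N), G ≤ G' ∧ AutEquiv (pauliD L m) G' := by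
  induction N using Nat.strong_induction_on with
  | _ N ih =>
  by_cases h : ∀ A : GL (Fin N) ℂ, Ad N A ∈ G → ∀ x ∈ G, x A = (A : Mat N)
  · obtain ⟨G', hle, he⟩ := exists_le_autEquiv_D hG h
    exact ⟨[], N, by simp, G', hle, (autEquiv_pauliD_nil N).symm.trans he⟩
  obtain ⟨n, hn, A, B, hAG, hBG, hBA, hA, hB⟩ := exists_pair_of_lifts_not_commute hN hG h
  have hn0 : n ≠ 0 := hn.ne_zero
  obtain ⟨W, hWn, hWA, hWG⟩ := exists_normalized_lift hn0 (hG.diag _ hAG) hA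
  obtain ⟨V, hVn, hVB, hVG⟩ := exists_normalized_lift hn0 (hG.diag _ hBG) hB
  -- `Ad_A` lies in `G` and fixes `V`, so `A` and `V` commute. Hence `Ad_V` fixes `A` and also `W`,
  -- and the corrections by `V` and `W` do not change the commutation scalar.
  have hAV : Ad N V A = (A : Mat N) :=
    Ad_fixes_iff.2 (Ad_fixes_iff.1 (hVG _ hAG)).symm
  have hBA' : Ad N (V⁻¹ * B) ((W⁻¹ * A : GL (Fin N) ℂ) : Mat N) =
      (omega n : ℂ) • ((W⁻¹ * A : GL (Fin N) ℂ) : Mat N) := by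
    have h1 : Ad N V ((W⁻¹ * A : GL (Fin N) ℂ) : Mat N) = (1 : ℂ) • _ :=
      apply_inv_mul_eq_smul (hWA _ hAV) (by rw [hAV, one_smul])
    rw [map_mul, AlgEquiv.mul_apply, apply_inv_mul_eq_smul (hWG _ hBG) hBA, map_smul, map_inv,
      inv_apply_eq_smul h1 one_ne_zero, inv_one, one_smul]
  obtain ⟨b, φ, hφA, hφB⟩ := exists_algEquiv_kron hn0 hWn hVn (Ad_apply_eq_smul_iff.1 hBA')
  let G₁ : Subgroup (AutMat (n * b)) := G.map (AlgEquiv.autCongr φ).toMonoidHom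
  have hGG₁ : AutEquiv G G₁ := ⟨φ, rfl⟩
  have hsize : N = n * b := hGG₁.size_eq
  have hb0 : b ≠ 0 := by
    rintro rfl
    exact hN hsize
  have hbN : b < N := by
    rw [hsize]
    exact lt_mul_of_one_lt_left (Nat.pos_of_ne_zero hb0) hn.one_lt
  have hG₁ := hGG₁.isAbelianDiagInner hG
  have heig (x : AutMat N) (X : Mat N) (Y : Mat (n * b)) (c : ℂ) (hX : φ X = Y)
      (hx : x X = c • X) : AlgEquiv.autCongr φ x Y = c • Y := by
    change φ (x (φ.symm Y)) = c • Y
    rw [← hX, AlgEquiv.symm_apply_apply, hx, map_smul]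
  obtain ⟨H, hH, hle⟩ := exists_le_tensorGroup_pauli hn0 hb0 hG₁ (by
    rintro _ ⟨x, hx, rfl⟩
    obtain ⟨c, hc, hxA⟩ := hA x hx
    obtain ⟨d, hd, hxB⟩ := hB x hx
    exact exists_eq_tensorAut hn0 hc hd
      (heig x _ _ c hφA (apply_inv_mul_eq_smul (hWG x hx) hxA))
      (heig x _ _ d hφB (apply_inv_mul_eq_smul (hVG x hx) hxB)))
  obtain ⟨L, m, hL, H', hHH', hH'⟩ := ih b hbN hb0 hH
  refine ⟨n :: L, m, fun k hk => ?_,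
    (tensorGroup (pauli n) H').comap (AlgEquiv.autCongr φ).toMonoidHom, ?_, ?_⟩
  · obtain rfl | hk := List.mem_cons.1 hk
    · exact hn
    · exact hL k hk
  · exact Subgroup.map_le_iff_le_comap.1 (hle.trans (tensorGroup_mono _ hHH'))
  · refine (autEquiv_pauliD_cons n L m).symm.trans
      (((AutEquiv.refl _).tensorGroup hH').trans (AutEquiv.symm ⟨φ, ?_⟩))
    rw [Subgroup.map_comap_eq_self_of_surjective]
    exact (AlgEquiv.autCongr φ).surjective

end Existence

/-! ### Classification of MAD-groups -/

section Main

variable {N : ℕ}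

theorem IsConjugate.symm {G H : Subgroup (AutMat N)} (h : IsConjugate G H) : IsConjugate H G :=
  autEquiv_iff_isConjugate.1 (autEquiv_iff_isConjugate.2 h).symm

theorem IsConjugate.trans {G H K : Subgroup (AutMat N)} (h : IsConjugate G H)
    (h' : IsConjugate H K) : IsConjugate G K :=
  autEquiv_iff_isConjugate.1
    ((autEquiv_iff_isConjugate.2 h').trans (autEquiv_iff_isConjugate.2 h))

theorem isConjugate_standard_iff (hN : N ≠ 0) {L L' : List ℕ} {m m' : ℕ} (h : Admissible N L m)
    (h' : Admissible N L' m') :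
    IsConjugate (standard L m h) (standard L' m' h') ↔ L'.Perm L ∧ m' = m := by
  have hm : m ≠ 0 := right_ne_zero_of_mul (h.prod_eq ▸ hN)
  have hm' : m' ≠ 0 := right_ne_zero_of_mul (h'.prod_eq ▸ hN)
  rw [← autEquiv_iff_isConjugate]
  constructor
  · intro he
    exact perm_of_autEquiv_pauliD h'.primePow h.primePow hm' hm
      (((autEquiv_standard h').trans he).trans (autEquiv_standard h).symm)
  · rintro ⟨hp, rfl⟩
    exact ((autEquiv_standard h').symm.trans (autEquiv_pauliD_of_perm hp m')).trans
      (autEquiv_standard h)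

theorem IsMAD.exists_isConjugate_standard (hN : N ≠ 0) {G : Subgroup (AutMat N)} (hG : IsMAD G) :
    ∃ (L : List ℕ) (m : ℕ) (h : Admissible N L m), IsConjugate G (standard L m h) := by
  obtain ⟨L, m, hL, G', hle, he⟩ := exists_le_autEquiv_pauliD hN hG.1
  have h : Admissible N L m := ⟨hL, he.size_eq⟩
  have hG' := he.isAbelianDiagInner (pauliD_isAbelianDiagInner h.ne_zero m)
  obtain rfl := Maximal.eq_of_le hG hG' hle
  exact ⟨L, m, h, autEquiv_iff_isConjugate.1 ((autEquiv_standard h).symm.trans he)⟩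

theorem IsMAD.exists_unique_standard (hN : N ≠ 0) {G : Subgroup (AutMat N)} (hG : IsMAD G) :
    ∃ (L : List ℕ) (m : ℕ) (h : Admissible N L m), IsConjugate G (standard L m h) ∧
      ∀ (L' : List ℕ) (m' : ℕ) (h' : Admissible N L' m'),
        IsConjugate G (standard L' m' h') ↔ L'.Perm L ∧ m' = m := by
  obtain ⟨L, m, h, hc⟩ := hG.exists_isConjugate_standard hN
  refine ⟨L, m, h, hc, fun L' m' h' => ?_⟩
  rw [← isConjugate_standard_iff hN h h']
  exact ⟨fun hc' => hc.symm.trans hc', fun hc' => hc.trans hc'⟩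

end Main

end PauliMAD

end

open PauliMAD in
theorem theorem5p1 (N : ℕ) (hN : 1 ≤ N) :
    -- every MAD-group is conjugate to one and only one standard group
    (∀ G : Subgroup (AutMat N), IsMAD G →
      ∃ (L : List ℕ) (m : ℕ) (h : Admissible N L m), IsConjugate G (standard L m h) ∧
        ∀ (L' : List ℕ) (m' : ℕ) (h' : Admissible N L' m'),
          IsConjugate G (standard L' m' h') ↔ L'.Perm L ∧ m' = m) ∧
    -- every standard group is a MAD-group
    (∀ (L : List ℕ) (m : ℕ) (h : Admissible N L m), IsMAD (standard L m h)) ∧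
    -- every fine grading induced by inner automorphisms is equivalent to one and only one
    -- of the gradings by the common eigenspaces of a standard group
    (∀ Γ : Set (Submodule ℂ (Mat N)), IsFineInnerGrading Γ →
      ∃ (L : List ℕ) (m : ℕ) (h : Admissible N L m),
        GradingEquiv Γ (eigenDecomposition (standard L m h : Set (AutMat N))) ∧
        ∀ (L' : List ℕ) (m' : ℕ) (h' : Admissible N L' m'),
          GradingEquiv Γ (eigenDecomposition (standard L' m' h' : Set (AutMat N))) ↔
            L'.Perm L ∧ m' = m) ∧
    -- and all of these gradings are fine
    (∀ (L : List ℕ) (m : ℕ) (h : Admissible N L m),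
      IsFineInnerGrading (eigenDecomposition (standard L m h : Set (AutMat N)))) := by
  have hN0 : N ≠ 0 := Nat.one_le_iff_ne_zero.1 hN
  refine ⟨fun G hG => hG.exists_unique_standard hN0, fun L m h => isMAD_standard hN0 h,
    fun Γ hΓ => ?_, fun L m h => (isMAD_standard hN0 h).isFineInnerGrading⟩
  -- The fine grading is the decomposition of its scalar group, a MAD-group, so the classification
  -- of groups carries over.
  have hG := hΓ.isMAD_scalarGroup
  obtain ⟨L, m, h, hc, huniq⟩ := hG.exists_unique_standard hN0
  have key (L' : List ℕ) (m' : ℕ) (h' : Admissible N L' m') :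
      GradingEquiv Γ (eigenDecomposition (standard L' m' h' : Set (AutMat N))) ↔
        IsConjugate (scalarGroup Γ) (standard L' m' h') := by
    rw [← gradingEquiv_eigenDecomposition_iff hG (isMAD_standard hN0 h'),
      eigenDecomposition_scalarGroup hΓ.1]
  exact ⟨L, m, h, (key L m h).2 hc, fun L' m' h' => (key L' m' h').trans (huniq L' m' h')⟩
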